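/- Let $\ell:\mathbb{R}^2\to\mathbb{R}$ be convex and $1$-Lipschitz in its second argument. Write $\ln_+ z=\max(0,\ln z)$, and $\partial^{(0,1)}\ell(y,\hat y)$ for the subdifferential of $\ell(y,\cdot)$ at $\hat y$. **Algorithm (modified FreeRange, dimension 1).** For features $x_1,x_2,\dots\in\mathbb{R}$ with $x_1\neq 0$ let $h_t=\max_{s\le t}|x_s|$ and $B_t=\sum_{s=1}^t |x_s|/h_s$. Start with $\tau=1$. In each round $t\ge 1$, if $h_t/h_\tau>B_{t-1}+1$, set $\tau=t$. Then, with $g_s=\delta_s x_s$, $V=h_\tau^2+\sum_{s=\tau}^{t-1}g_s^2$ and $G=\sum_{s=\tau}^{t-1}g_s$, output $$\hat u_t=\frac{1}{h_\tau B_\tau}\,\hat w_t,\qquad \hat w_t=-G\cdot\frac{(2V+h_t|G|)\,h_\tau^2}{2(V+h_t|G|)^2\sqrt V}\,\exp\!\Big(\frac{G^2}{2V+2h_t|G|}\Big),$$ predict $\hat y_t=x_t\hat u_t$, and then receive $\delta_t$. For $T\ge1$ let $V_T=x_1^2+\sum_{t=1}^T\delta_t^2x_t^2$, $c_T=2B_T^2\sum_{t=1}^T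 B_t^2$, and $$\mathcal{R}_T(w)=2|w|\sqrt{V_T\ln_+(2|w|^2V_Tc_T)}+h_T|w|\big(14\ln_+(2|w|\sqrt{2V_Tc_T})+1\big)+2+\ln B_T .$$ 1. **Regret bound.** For all $w\in\mathbb{R}$, $T\ge1$, all $(x_t,y_t)\subset\mathbb{R}^2$ with $x_1\ne0$, and all $\delta_t\in\partial^{(0,1)}\ell(y_t,x_t\hat u_t)$, $t=1,\dots,T$, $$\sum_{t=1}^T\delta_tx_t(\hat u_t-w)\le \mathcal{R}_T(w)\quad\text{and}\quad \sum_{t=1}^T\ell(y_t,\hat y_t)-\sum_{t=1}^T\ell(y_t,wx_t)\le \mathcal{R}_T(w).$$ Moreover $B_T\le T$ and $c_T\le 2T^5$, and $c_T\le T^5$ if $T\ge4$. 2. **Scale-invariance.** For each $t\geq 1$, the prediction $\hat y_t$, which is determined by $x_1,\dots,x_t$ and $\delta_1,\dots,\delta_{t-1}$, does not change if all the features are multiplied by a common $a>0$ while $\delta_1,\dots,\delta_{t-1}$ stay the same. 3. **Coordinate-wise version.** For features $x_t\in\mathbb{R}^d$ with $x_{1,i}\ne0$ for all $i$, run one copy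 of the algorithm on each coordinate sequence $(x_{t,i})_t$, with outputs $\hat u_{t,i}$, and predict $\hat y_t=\sum_{i=1}^d x_{t,i}\hat u_{t,i}$; all copies receive the same $\delta_t$. For all $w\in\mathbb{R}^d$, $T\ge1$, labels $(y_t)\subset\mathbb{R}$, and $\delta_t\in\partial^{(0,1)}\ell(y_t,\hat y_t)$, $t=1,\dots,T$, $$\sum_{t=1}^T\delta_t\langle x_t,\hat u_t-w\rangle\le\sum_{i=1}^d\mathcal{R}_{T,i}(w_i)\quad\text{and}\quad\sum_{t=1}^T\ell(y_t,\hat y_t)-\sum_{t=1}^T\ell(y_t,\langle w,x_t\rangle)\le\sum_{i=1}^d\mathcal{R}_{T,i}(w_i),$$ where $\mathcal{R}_{T,i}$ is $\mathcal{R}_T$ formed with the sequences $(x_{t,i})_t$ and $(\delta_t)_t$. Each $\hat y_t$ is unchanged when, for every $i$, the $i$-th coordinate of all the features is multiplied by some $a_i>0$ and $\delta_1,\dots,\delta_{t-1}$ stay the same. -/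

import Mathlib

open Finset
open scoped BigOperators

noncomputable section

namespace OnlineLinear

/-! Rounds are numbered from `1`; the entry of a sequence `ℕ → _` at index `0` is never used. -/

/-- The subdifferential of a function `f : ℝ → ℝ` at the point `a`. -/
def subdifferential (f : ℝ → ℝ) (a : ℝ) : Set ℝ :=
  {δ | ∀ z : ℝ, f a + δ * (z - a) ≤ f z}

/-- The hint `h_t = max_{1 ≤ s ≤ t} |x_s|` (and `h_0 = 0`). -/
def hint (x : ℕ → ℝ) : ℕ → ℝ
  | 0 => 0
  | t + 1 => max (hint x t) |x (t + 1)|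

/-- `B_t = ∑_{s=1}^t |x_s| / h_s`. -/
def ratioSum (x : ℕ → ℝ) (t : ℕ) : ℝ :=
  ∑ s ∈ Icc 1 t, |x s| / hint x s

/-- The one-dimensional FreeGrad iterate, as a function of the initial hint `h₁`, the
current statistics `V = h₁² + ∑ g_s²` and `G = ∑ g_s` of the past sub-gradients, and the
hint `h` for the current round. -/
def freeGrad (h₁ V G h : ℝ) : ℝ :=
  -G * (((2 * V + h * |G|) * h₁ ^ 2) / (2 * (V + h * |G|) ^ 2 * Real.sqrt V))
    * Real.exp (|G| ^ 2 / (2 * V + 2 * h * |G|))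

open scoped Classical in
/-- The value of the variable `τ` of the restart wrapper in round `t`, after the restart test:
the first round of the epoch that contains round `t`. -/
def epochStart (x : ℕ → ℝ) : ℕ → ℕ
  | 0 => 1
  | t + 1 =>
      if hint x (t + 1) / hint x (epochStart x t) > ratioSum x t + 1 then t + 1
      else epochStart x t

/-- The output `û_t` in round `t` of the modified FreeRange algorithm, on the feature
sequence `x` and the sub-gradient sequence `g` (only `x_1, …, x_t` and `g_1, …, g_{t-1}` are
used): the FreeGrad iterate of the current epoch, divided by `h_τ * ∑_{s=1}^τ |x_s| / h_s`. -/
def freeRange (x g : ℕ → ℝ) (t : ℕ) : ℝ :=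
  let τ := epochStart x t
  freeGrad (hint x τ) (hint x τ ^ 2 + ∑ s ∈ Ico τ t, |g s| ^ 2) (∑ s ∈ Ico τ t, g s) (hint x t)
    * (hint x τ * ratioSum x τ)⁻¹

/-- `û_t` in online linear prediction, where the sub-gradients are `g_s = x_s δ_s`. -/
def weight (x δ : ℕ → ℝ) (t : ℕ) : ℝ :=
  freeRange x (fun s => x s * δ s) t

/-- The prediction `ŷ_t = x_t û_t`. -/
def prediction (x δ : ℕ → ℝ) (t : ℕ) : ℝ :=
  x t * weight x δ t

/-- The coordinate-wise prediction `ŷ_t = ∑_i x_{t,i} û_{t,i}`, where `û_{·,i}` is the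
output of the algorithm run on the `i`-th coordinate of the features. -/
def coordPrediction {d : ℕ} (x : ℕ → Fin d → ℝ) (δ : ℕ → ℝ) (t : ℕ) : ℝ :=
  ∑ i, x t i * weight (fun s => x s i) δ t

/-- `V_T = |x_1|² + ∑_{t=1}^T δ_t² x_t²`. -/
def variance (x δ : ℕ → ℝ) (T : ℕ) : ℝ :=
  |x 1| ^ 2 + ∑ t ∈ Icc 1 T, δ t ^ 2 * x t ^ 2

/-- `c_T = 2 B_T² ∑_{t=1}^T B_t²`. -/
def ratioConst (x : ℕ → ℝ) (T : ℕ) : ℝ :=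
  2 * ratioSum x T ^ 2 * ∑ t ∈ Icc 1 T, ratioSum x t ^ 2

/-- `ln_+ z = max 0 (ln z)`. -/
def lnPlus (z : ℝ) : ℝ := max 0 (Real.log z)

/-- The right-hand side of the regret bound against the comparator `w` after `T` rounds. -/
def regretBound (x δ : ℕ → ℝ) (w : ℝ) (T : ℕ) : ℝ :=
  2 * |w| * Real.sqrt (variance x δ T *
      lnPlus (2 * |w| ^ 2 * variance x δ T * ratioConst x T))
    + hint x T * |w| *
      (14 * lnPlus (2 * |w| * Real.sqrt (2 * variance x δ T * ratioConst x T)) + 1)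
    + (2 + Real.log (ratioSum x T))

end OnlineLinear

end

namespace OnlineLinear

/-! The FreeGrad iterate is minus the derivative in `G` of the potential `Φ = h₁² / √V * exp (G² /
(2V + 2h|G|))`. The core inequality, `potential_step`, says that a round's loss plus the new
potential is at most the old potential. A growing hint only lowers `Φ`, and at the start of an epoch
`Φ = h_τ`. So, after the normalisation by `h_τ B_τ`, an epoch loses at most `1 / B_τ` minus its
final potential.

A restart happens only at a round that sets a new maximal feature, where `B` grows by exactly `1`.
Hence the terms `1 / B_τ` are bounded by increments of `log B` and add up to at most `1 + log B_T`
(`total_loss_le`). The final potentials of the last two epochs are kept on the credit side.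

The comparator costs at most `|w|` times the absolute sum of the sub-gradients, split into three
blocks. All epochs before the last two together contribute at most `h_T |w|`, because the restart
test forces the hint to outgrow everything accumulated earlier. In each of the last two epochs the
retained potential pays: either the block sum is small, or the exponential exceeds `|w| |G|`
(`comparator_sub_potential_le`). Two such epochs give the constant `14 = 2 * 7` and the factor `2`
before the square root. If `|w|` is so small that the logarithmic argument is useless, the
comparator costs at most `1`, which the constant term absorbs.

Regret reduces to linearized regret by the sub-gradient inequality, and scale-invariance is
homogeneity of the iterate. -/

/-! ### The one-step potential inequality with unit hint -/

/-- With `m = G / (V + G)`, the coefficient `m - m ^ 2 / 2` is the derivative of the exponent `G ^ 2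
/ (2 * V + 2 * G)`. The quadratic loss allowed here is exactly the term `-m ^ 2 * g ^ 2 / 2` in the
expansion of the exponent. -/
theorem log_one_sub_lower_bound {m q : ℝ} (hm0 : 0 ≤ m) (hm1 : m ≤ 1) (hq : |q| ≤ 1) :
    -((m - m ^ 2 / 2) * q) - m ^ 2 * q ^ 2 / 2 ≤ Real.log (1 - (m - m ^ 2 / 2) * q) := by
  have hw0 : 0 ≤ m - m ^ 2 / 2 := by nlinarith
  have hwm : m - m ^ 2 / 2 ≤ m := by nlinarith
  have hw1 : m - m ^ 2 / 2 ≤ 1 / 2 := by nlinarith [sq_nonneg (m - 1)]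
  obtain ⟨hql, hqu⟩ := abs_le.mp hq
  rcases le_total q 0 with h | h
  · set w := (m - m ^ 2 / 2) * (-q) with hw
    have hwn : 0 ≤ w := mul_nonneg hw0 (by linarith)
    have h1 := Real.le_log_one_add_of_nonneg hwn
    have h2 : w - w ^ 2 / 2 ≤ 2 * w / (w + 2) := by
      rw [le_div_iff₀ (by linarith)]
      nlinarith [pow_nonneg hwn 3]
    have h3 : w ^ 2 ≤ (m * (-q)) ^ 2 :=
      pow_le_pow_left₀ hwn (mul_le_mul_of_nonneg_right hwm (by linarith)) 2
    have h4 : 1 - (m - m ^ 2 / 2) * q = 1 + w := by rw [hw]; ring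
    have h5 : (m - m ^ 2 / 2) * q = -w := by rw [hw]; ring
    rw [h4, h5]
    nlinarith
  · set z := (m - m ^ 2 / 2) * q with hz
    have hz0 : 0 ≤ z := mul_nonneg hw0 h
    have hzw : z ≤ m - m ^ 2 / 2 := by nlinarith
    have hz1 : z ≤ 1 / 2 := by linarith
    have h1 := Real.abs_log_sub_add_sum_range_le (x := z) (by rw [abs_of_nonneg hz0]; linarith) 3
    rw [abs_of_nonneg hz0] at h1
    simp only [Finset.sum_range_succ, Finset.sum_range_zero] at h1
    norm_num at h1
    have h2 := (abs_le.mp h1).1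
    suffices h3 : z ^ 2 / 2 + z ^ 3 / 3 + z ^ 4 / (1 - z) ≤ m ^ 2 * q ^ 2 / 2 by linarith
    -- Dividing by `(m * q) ^ 2` leaves an expression increasing in `z`, so the worst case is `q =
    -- 1`, a polynomial inequality in `m` alone.
    have key : (1 - m / 2) ^ 2 * (1 / 2 + z / 3 + z ^ 2 / (1 - z)) ≤ 1 / 2 := by
      set w := m - m ^ 2 / 2 with hwd
      have h4 : z ^ 2 / (1 - z) ≤ w ^ 2 / (1 - w) := by
        apply div_le_div₀ (by positivity) (pow_le_pow_left₀ hz0 hzw 2) (by linarith) (by linarith)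
      have h5 : (1 - m / 2) ^ 2 * (1 / 2 + w / 3 + w ^ 2 / (1 - w)) ≤ 1 / 2 := by
        have h6 : 0 < 1 - w := by linarith
        rw [show 1 / 2 + w / 3 + w ^ 2 / (1 - w)
          = ((1 / 2 + w / 3) * (1 - w) + w ^ 2) / (1 - w) by field_simp, ← mul_div_assoc,
          div_le_iff₀ h6, hwd]
        have h7 : 0 ≤ 1 / 2 * (m / 2) + (1 - m / 2) ^ 3 / 3 - 8 / 3 * (1 - m / 2) ^ 4 * (m / 2) := by
          have h0 : 0 ≤ 1 - m / 2 := by linarith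
          have h1 : 0 ≤ m / 2 := by linarith
          set r := 1 - m / 2 with hr
          have h8 : m / 2 = 1 - r := by rw [hr]; ring
          rw [h8] at h1 ⊢
          nlinarith [mul_nonneg h0 (sq_nonneg (r ^ 2 - 0.8 * r)), sq_nonneg (r ^ 2 - 0.6),
            sq_nonneg (r - 0.78), mul_nonneg h0 (sq_nonneg (r - 0.78)),
            mul_nonneg h0 (sq_nonneg (r ^ 2 - 0.6)), sq_nonneg (r ^ 2 - 0.8 * r),
            mul_nonneg h1 (sq_nonneg (r ^ 2 - 0.6)), mul_nonneg h1 (sq_nonneg (r ^ 2 - 0.8 * r))]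
        nlinarith [mul_nonneg hm0 h7]
      refine le_trans ?_ h5
      gcongr
    calc z ^ 2 / 2 + z ^ 3 / 3 + z ^ 4 / (1 - z)
        = (m * q) ^ 2 * ((1 - m / 2) ^ 2 * (1 / 2 + z / 3 + z ^ 2 / (1 - z))) := by
          have : 1 - z ≠ 0 := by linarith
          field_simp
          rw [hz]; ring
      _ ≤ (m * q) ^ 2 * (1 / 2) := by gcongr
      _ = _ := by ring

/-- The cubic terms in `v` cancel. The coefficient of `v ^ 2` is `quad`; the rest is `t` times an
affine function of `v`, whose slope is at least `0.9`, so `v ≥ q / 6` outweighs a constant term no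
lower than `-(3 / 20) * q`. -/
theorem crossing_polynomial_nonneg {q t v : ℝ} (ht0 : 0 ≤ t) (ht1 : t ≤ 1) (hq0 : 0 ≤ q)
    (hq1 : q ≤ 1) (hv : q / 6 ≤ v) :
    0 ≤ (2 * (t + v) ^ 2 + 2 * t ^ 2 * (1 - t) * (2 * v + q)) * (v + 1 + q - t)
      - (v + t * (2 + q - 2 * t)) ^ 2 * (2 * v + q) := by
  have ht1' := sub_nonneg.2 ht1
  have hv0 : 0 ≤ v := by linarith
  have quad : 0 ≤ 2 + q - 6 * t - 4 * t * q + 12 * t ^ 2 - 4 * t ^ 3 := by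
    have h1 : 0 ≤ 2 - 6 * t + 12 * t ^ 2 - 4 * t ^ 3 := by
      nlinarith [sq_nonneg (t - 0.35), mul_nonneg ht0 (sq_nonneg (t - 0.35)),
        mul_nonneg ht1' (sq_nonneg (t - 0.35))]
    have h2 : 0 ≤ 3 - 10 * t + 12 * t ^ 2 - 4 * t ^ 3 := by
      nlinarith [sq_nonneg (t - 0.63), mul_nonneg ht0 (sq_nonneg (t - 0.63)),
        mul_nonneg ht1' (sq_nonneg (t - 0.63))]
    nlinarith
  have lin : 0.9 ≤ 4 * ((1 - t) + q) + 2 * t - 2 * q * (2 + q - 2 * t)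
      - 2 * t * (2 + q - 2 * t) ^ 2 + t * (1 - t) * (4 * ((1 - t) + q) + 2 * q) := by
    have h1 : 0.9 ≤ 2 + 2 * t - 2 * t * (3 - 2 * t) ^ 2 + t * (1 - t) * (4 * (2 - t) + 2) := by
      nlinarith [sq_nonneg (t - 0.39), mul_nonneg ht0 (sq_nonneg (t - 0.39)),
        mul_nonneg ht1' (sq_nonneg (t - 0.39))]
    have h2 : 0 ≤ (1 - q) *
        (2 * (1 + q) - 4 * t + 2 * t * (5 + q - 4 * t) - 6 * (t * (1 - t))) := by
      apply mul_nonneg (by linarith)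
      nlinarith [mul_nonneg ht0 hq0, mul_nonneg ht0 ht1']
    nlinarith
  have const : 0 ≤ q * (3 / 20)
      + t * (2 * ((1 - t) + q) * (1 + q * (1 - t)) - q * (2 * (1 - t) + q) ^ 2) := by
    have h1 : t * (q * (1 - 2 * (1 - t) ^ 2))
        ≤ t * (2 * ((1 - t) + q) * (1 + q * (1 - t)) - q * (2 * (1 - t) + q) ^ 2) := by
      gcongr
      nlinarith [mul_nonneg (by linarith : 0 ≤ 2 * (1 - t) + q) (by nlinarith : 0 ≤ 1 - q ^ 2)]
    have h2 : 0 ≤ q * (3 / 20 + t * (1 - 2 * (1 - t) ^ 2)) := by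
      apply mul_nonneg hq0
      nlinarith [sq_nonneg (t - 0.147), mul_nonneg ht0 (sq_nonneg (t - 0.147)),
        mul_nonneg ht1' (sq_nonneg (t - 0.147))]
    nlinarith
  have h1 := mul_nonneg (sq_nonneg v) quad
  have h2 : q * (3 / 20) ≤ v * (4 * ((1 - t) + q) + 2 * t - 2 * q * (2 + q - 2 * t)
      - 2 * t * (2 + q - 2 * t) ^ 2 + t * (1 - t) * (4 * ((1 - t) + q) + 2 * q)) := by
    calc q * (3 / 20) = (q / 6) * 0.9 := by ring
      _ ≤ _ := mul_le_mul hv lin (by norm_num) hv0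
  have h3 := mul_nonneg ht0 (const.trans (add_le_add_left h2 _))
  nlinarith

theorem crossing_bound {V a q : ℝ} (hV : 0 < V) (ha : 0 ≤ a) (haq : a < q) (hq : q ≤ 1)
    (hVq : q ^ 2 / 6 ≤ V) :
    (q + a / (V + a) * (q + q ^ 2 - 2 * a)) ^ 2 / (V + q ^ 2 + q - a)
      ≤ q ^ 2 / (V + q ^ 2 / 2) + 2 * (a / (V + a)) ^ 2 * (q - a) := by
  have hq0 : 0 < q := by linarith
  obtain ⟨t, rfl⟩ : ∃ t, a = t * q := ⟨a / q, by field_simp⟩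
  obtain ⟨v, rfl⟩ : ∃ v, V = v * q := ⟨V / q, by field_simp⟩
  have hv : 0 < v := pos_of_mul_pos_left hV hq0.le
  have ht0 : 0 ≤ t := nonneg_of_mul_nonneg_left ha hq0
  have ht1 : t ≤ 1 := by nlinarith
  have hvq : q / 6 ≤ v := by
    by_contra! h
    nlinarith
  have hP := crossing_polynomial_nonneg ht0 ht1 hq0.le hq hvq
  have e1 : 0 < v + 1 + q - t := by linarith
  have e2 : 0 < v + t := by linarith
  have e3 : 0 < 2 * v + q := by linarith
  rw [← sub_nonneg]
  have e : q ^ 2 / (v * q + q ^ 2 / 2) + 2 * (t * q / (v * q + t * q)) ^ 2 * (q - t * q)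
      - (q + t * q / (v * q + t * q) * (q + q ^ 2 - 2 * (t * q))) ^ 2
        / (v * q + q ^ 2 + q - t * q)
      = q * ((2 * (t + v) ^ 2 + 2 * t ^ 2 * (1 - t) * (2 * v + q)) * (v + 1 + q - t)
      - (v + t * (2 + q - 2 * t)) ^ 2 * (2 * v + q))
        / ((2 * v + q) * (v + t) ^ 2 * (v + 1 + q - t)) := by
    rw [show v * q + q ^ 2 / 2 = q * (2 * v + q) / 2 by ring,
      show v * q + t * q = q * (v + t) by ring,
      show v * q + q ^ 2 + q - t * q = q * (v + 1 + q - t) by ring]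
    field_simp
    ring
  rw [e]
  positivity

/-- The exponent of the FreeGrad potential with unit hint. -/
noncomputable def potentialExponent (G V : ℝ) : ℝ := |G| ^ 2 / (2 * V + 2 * |G|)

theorem potentialExponent_step_noncrossing {V G g : ℝ} (hV : 0 < V) (hG : 0 ≤ G)
    (hg : |g| ≤ 1) (hGg : 0 ≤ G + g) :
    potentialExponent (G + g) (V + g ^ 2) - potentialExponent G V
      ≤ 1 / 2 * Real.log (1 + g ^ 2 / V)
        + Real.log (1 + G * (2 * V + G) / (2 * (V + G) ^ 2) * g) := by
  obtain ⟨hgl, hgu⟩ := abs_le.mp hg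
  have hy : 0 < V + G := by linarith
  have hw : 0 < V + g ^ 2 := by positivity
  have hw' : 0 < V + g ^ 2 + (G + g) := by linarith
  set m := G / (V + G) with hm
  have hm0 : 0 ≤ m := by positivity
  have hm1 : m ≤ 1 := by rw [hm, div_le_one hy]; linarith
  have hc : G * (2 * V + G) / (2 * (V + G) ^ 2) = m - m ^ 2 / 2 := by
    rw [hm]; field_simp; ring
  have id1 : potentialExponent (G + g) (V + g ^ 2) - potentialExponent G V
      = (m - m ^ 2 / 2) * g - m ^ 2 * g ^ 2 / 2
        + g ^ 2 / 2 * ((1 - m - m * g) ^ 2 / (V + g ^ 2 + (G + g))) := by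
    rw [potentialExponent, potentialExponent, abs_of_nonneg hGg, abs_of_nonneg hG, hm,
      show 2 * (V + g ^ 2) + 2 * (G + g) = 2 * (V + g ^ 2 + (G + g)) by ring,
      show 2 * V + 2 * G = 2 * (V + G) by ring]
    field_simp
    ring
  have h1 := log_one_sub_lower_bound hm0 hm1 (q := -g) (by rwa [abs_neg])
  have h2 := Real.one_sub_inv_le_log_of_pos (x := 1 + g ^ 2 / V) (by positivity)
  have h3 : 1 - (1 + g ^ 2 / V)⁻¹ = g ^ 2 * (1 / (V + g ^ 2)) := by
    field_simp
    ring
  have h4 : (1 - m - m * g) ^ 2 / (V + g ^ 2 + (G + g)) ≤ 1 / (V + g ^ 2) := by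
    apply div_le_div₀ zero_le_one _ hw (by linarith)
    rw [sq_le_one_iff_abs_le_one, abs_le]
    constructor <;> nlinarith
  have h5 : 1 - (m - m ^ 2 / 2) * -g = 1 + (m - m ^ 2 / 2) * g := by ring
  rw [h5] at h1
  rw [id1, hc]
  have h6 := mul_le_mul_of_nonneg_left h4 (by positivity : 0 ≤ g ^ 2 / 2)
  nlinarith

/-- When the sum changes sign, `|G|` has a kink and the expansion gains other terms. For `V ≥ q ^ 2
/ 6` these are handled by `crossing_bound`. For smaller `V` the new exponent is at most `1 / 4`,
while the logarithms contribute at least `log 7 / 2 - log 2 ≥ 1 / 4`. -/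
theorem potentialExponent_step_crossing {V a q : ℝ} (hV : 0 < V) (ha : 0 ≤ a) (haq : a < q)
    (hq : q ≤ 1) :
    potentialExponent (a - q) (V + q ^ 2) - potentialExponent a V
      ≤ 1 / 2 * Real.log (1 + q ^ 2 / V)
        + Real.log (1 - a * (2 * V + a) / (2 * (V + a) ^ 2) * q) := by
  have hq0 : 0 < q := by linarith
  have hy : 0 < V + a := by linarith
  have hw : 0 < V + q ^ 2 + q - a := by nlinarith
  set m := a / (V + a) with hm
  have hm0 : 0 ≤ m := by positivity
  have hm1 : m ≤ 1 := by rw [hm, div_le_one hy]; linarith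
  have hc : a * (2 * V + a) / (2 * (V + a) ^ 2) = m - m ^ 2 / 2 := by
    rw [hm]; field_simp; ring
  rw [hc]
  have hx : |a - q| = q - a := by rw [abs_of_neg (by linarith)]; ring
  rcases le_total (q ^ 2 / 6) V with hVq | hVq
  · have id1 : potentialExponent (a - q) (V + q ^ 2) - potentialExponent a V
        = -((m - m ^ 2 / 2) * q) - m ^ 2 * (q - a) - m ^ 2 * q ^ 2 / 2
          + 1 / 2 * ((q + m * (q + q ^ 2 - 2 * a)) ^ 2 / (V + q ^ 2 + q - a)) := by
      rw [potentialExponent, potentialExponent, hx, abs_of_nonneg ha, hm,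
        show 2 * (V + q ^ 2) + 2 * (q - a) = 2 * (V + q ^ 2 + q - a) by ring,
        show 2 * V + 2 * a = 2 * (V + a) by ring]
      field_simp
      ring
    have h1 := log_one_sub_lower_bound hm0 hm1 (q := q) (by rwa [abs_of_pos hq0])
    have h2 := Real.le_log_one_add_of_nonneg (x := q ^ 2 / V) (by positivity)
    have h3 : 2 * (q ^ 2 / V) / (q ^ 2 / V + 2) = q ^ 2 / (V + q ^ 2 / 2) := by
      field_simp
      ring
    have h4 := crossing_bound hV ha haq hq hVq
    rw [← hm] at h4
    rw [id1]
    linarith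
  · have h1 : 7 ≤ 1 + q ^ 2 / V := by
      have : 6 ≤ q ^ 2 / V := by rw [le_div_iff₀ hV]; linarith
      linarith
    have h2 : Real.log 7 ≤ Real.log (1 + q ^ 2 / V) := Real.log_le_log (by norm_num) h1
    have h3 : (m - m ^ 2 / 2) * q ≤ 1 / 2 := by nlinarith [sq_nonneg (m - 1)]
    have h4 : Real.log (1 / 2) ≤ Real.log (1 - (m - m ^ 2 / 2) * q) :=
      Real.log_le_log (by norm_num) (by linarith)
    have h5 : potentialExponent (a - q) (V + q ^ 2) ≤ 1 / 4 := by
      rw [potentialExponent, hx, div_le_iff₀ (by linarith)]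
      nlinarith
    have h6 : 0 ≤ potentialExponent a V := by rw [potentialExponent]; positivity
    have h7 : 1 / 2 ≤ Real.log 7 - 2 * Real.log 2 := by
      have : Real.log 7 - 2 * Real.log 2 = Real.log (7 / 4) := by
        rw [Real.log_div (by norm_num) (by norm_num), show (4 : ℝ) = 2 ^ 2 by norm_num,
          Real.log_pow]
        norm_num
      rw [this, Real.le_log_iff_exp_le (by norm_num),
        show (1 / 2 : ℝ) = 1 * (1 / 2) by norm_num, Real.exp_mul, ← Real.sqrt_eq_rpow]
      rw [Real.sqrt_le_left (by norm_num)]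
      have := Real.exp_one_lt_d9
      norm_num at this ⊢
      linarith
    have h8 : Real.log (1 / 2) = -Real.log 2 := by rw [one_div, Real.log_inv]
    linarith

theorem potentialExponent_neg (G V : ℝ) : potentialExponent (-G) V = potentialExponent G V := by
  simp [potentialExponent]

theorem slope_abs_le_half {V G : ℝ} (hV : 0 < V) :
    |G * (2 * V + |G|) / (2 * (V + |G|) ^ 2)| ≤ 1 / 2 := by
  have hy : 0 < V + |G| := by positivity
  rw [abs_div, abs_mul, abs_of_pos (by positivity : 0 < 2 * V + |G|),
    abs_of_pos (by positivity : 0 < 2 * (V + |G|) ^ 2), div_le_iff₀ (by positivity)]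
  nlinarith [sq_nonneg V]

theorem potentialExponent_step {V G g : ℝ} (hV : 0 < V) (hg : |g| ≤ 1) :
    potentialExponent (G + g) (V + g ^ 2) - potentialExponent G V
      ≤ 1 / 2 * Real.log (1 + g ^ 2 / V)
        + Real.log (1 + G * (2 * V + |G|) / (2 * (V + |G|) ^ 2) * g) := by
  have pos : ∀ {G g : ℝ}, |g| ≤ 1 → 0 ≤ G →
      potentialExponent (G + g) (V + g ^ 2) - potentialExponent G V
      ≤ 1 / 2 * Real.log (1 + g ^ 2 / V)
        + Real.log (1 + G * (2 * V + |G|) / (2 * (V + |G|) ^ 2) * g) := by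
    intro G g hg hG
    rw [abs_of_nonneg hG]
    rcases le_or_gt 0 (G + g) with h | h
    · exact potentialExponent_step_noncrossing hV hG hg h
    · have := potentialExponent_step_crossing hV hG (q := -g) (by linarith)
        (by linarith [(abs_le.mp hg).1])
      simpa [sub_neg_eq_add] using this
  rcases le_total 0 G with hG | hG
  · exact pos hg hG
  · have := pos (G := -G) (g := -g) (by rwa [abs_neg]) (by linarith)
    rw [← neg_add, potentialExponent_neg, potentialExponent_neg, abs_neg, neg_sq] at this
    convert this using 3
    ring

/-- The FreeGrad potential. -/
noncomputable def potential (h₁ V G h : ℝ) : ℝ :=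
  h₁ ^ 2 / Real.sqrt V * Real.exp (|G| ^ 2 / (2 * V + 2 * h * |G|))

theorem potential_nonneg (h₁ V G h : ℝ) : 0 ≤ potential h₁ V G h := by
  unfold potential; positivity

/-- Divided by the old potential and put in logarithms, this is `potentialExponent_step`: the term
`1 / 2 * log (1 + g ^ 2 / V)` comes from the prefactor `1 / √V`, the other from the linear loss. The
slope bound `1 / 2` keeps the argument of the latter logarithm positive. -/
theorem potential_step_unit {V G g : ℝ} (hV : 0 < V) (hg : |g| ≤ 1) :
    g * freeGrad 1 V G 1 + potential 1 (V + g ^ 2) (G + g) 1 ≤ potential 1 V G 1 := by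
  have hw : 0 < V + g ^ 2 := by positivity
  have hc : 0 < 1 + G * (2 * V + |G|) / (2 * (V + |G|) ^ 2) * g := by
    have h1 := slope_abs_le_half (G := G) hV
    have h2 : |G * (2 * V + |G|) / (2 * (V + |G|) ^ 2) * g| ≤ 1 / 2 * 1 := by
      rw [abs_mul]; gcongr
    linarith [(abs_le.mp h2).1]
  have hl := potentialExponent_step (G := G) hV hg
  have h1 : Real.exp (potentialExponent (G + g) (V + g ^ 2))
      ≤ Real.exp (potentialExponent G V) * (Real.sqrt (1 + g ^ 2 / V)
        * (1 + G * (2 * V + |G|) / (2 * (V + |G|) ^ 2) * g)) := by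
    rw [← Real.exp_log (x := Real.sqrt (1 + g ^ 2 / V)
        * (1 + G * (2 * V + |G|) / (2 * (V + |G|) ^ 2) * g)) (by positivity),
      ← Real.exp_add, Real.exp_le_exp, Real.log_mul (by positivity) hc.ne',
      Real.log_sqrt (by positivity)]
    linarith
  have h2 : Real.sqrt (V + g ^ 2) = Real.sqrt V * Real.sqrt (1 + g ^ 2 / V) := by
    rw [← Real.sqrt_mul hV.le]; congr 1; field_simp
  have hs : 0 < Real.sqrt V := Real.sqrt_pos.2 hV
  have hs2 : 0 < Real.sqrt (1 + g ^ 2 / V) := Real.sqrt_pos.2 (by positivity)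
  have h3 : potential 1 (V + g ^ 2) (G + g) 1 ≤ Real.exp (potentialExponent G V) / Real.sqrt V
        * (1 + G * (2 * V + |G|) / (2 * (V + |G|) ^ 2) * g) := by
    unfold potential
    simp only [one_pow, mul_one]
    change _ * Real.exp (potentialExponent (G + g) (V + g ^ 2)) ≤ _
    rw [h2]
    calc _ ≤ 1 / (Real.sqrt V * Real.sqrt (1 + g ^ 2 / V)) *
          (Real.exp (potentialExponent G V) * (Real.sqrt (1 + g ^ 2 / V)
        * (1 + G * (2 * V + |G|) / (2 * (V + |G|) ^ 2) * g))) := by gcongr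
      _ = _ := by field_simp
  have h4 : g * freeGrad 1 V G 1 = -(Real.exp (potentialExponent G V) / Real.sqrt V
        * (G * (2 * V + |G|) / (2 * (V + |G|) ^ 2) * g)) := by
    unfold freeGrad potentialExponent
    have : 0 < V + |G| := by positivity
    simp only [one_pow, mul_one, one_mul]
    field_simp
  have h5 : potential 1 V G 1 = Real.exp (potentialExponent G V) / Real.sqrt V := by
    unfold potential potentialExponent
    simp only [one_pow, mul_one]
    ring
  rw [h4, h5]
  linarith

/-! ### Homogeneity, and the potential step for arbitrary hints -/

theorem freeGrad_scale {a : ℝ} (ha : 0 < a) (h₁ V G h : ℝ) :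
    freeGrad (a * h₁) (a ^ 2 * V) (a * G) (a * h) = freeGrad h₁ V G h := by
  unfold freeGrad
  rw [abs_mul, abs_of_pos ha, Real.sqrt_mul (by positivity), Real.sqrt_sq ha.le,
    show (a * |G|) ^ 2 / (2 * (a ^ 2 * V) + 2 * (a * h) * (a * |G|))
      = (a ^ 2 * |G| ^ 2) / (a ^ 2 * (2 * V + 2 * h * |G|)) by ring_nf,
    mul_div_mul_left _ _ (by positivity : a ^ 2 ≠ 0),
    show -(a * G) * ((2 * (a ^ 2 * V) + a * h * (a * |G|)) * (a * h₁) ^ 2 /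
        (2 * (a ^ 2 * V + a * h * (a * |G|)) ^ 2 * (a * Real.sqrt V)))
      = -G * ((a ^ 5 * ((2 * V + h * |G|) * h₁ ^ 2)) /
        (a ^ 5 * (2 * (V + h * |G|) ^ 2 * Real.sqrt V))) * (a / a) * 1 by
      field_simp]
  rw [mul_div_mul_left _ _ (by positivity : a ^ 5 ≠ 0), div_self ha.ne']
  ring

theorem potential_scale {a : ℝ} (ha : 0 < a) (h₁ V G h : ℝ) :
    potential (a * h₁) (a ^ 2 * V) (a * G) (a * h) = a * potential h₁ V G h := by
  unfold potential
  rw [abs_mul, abs_of_pos ha, Real.sqrt_mul (by positivity), Real.sqrt_sq ha.le,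
    show (a * |G|) ^ 2 / (2 * (a ^ 2 * V) + 2 * (a * h) * (a * |G|))
      = (a ^ 2 * |G| ^ 2) / (a ^ 2 * (2 * V + 2 * h * |G|)) by ring_nf,
    mul_div_mul_left _ _ (by positivity : a ^ 2 ≠ 0)]
  field_simp

theorem freeGrad_eq_sq_mul (h₁ V G h : ℝ) : freeGrad h₁ V G h = h₁ ^ 2 * freeGrad 1 V G h := by
  unfold freeGrad; ring

theorem potential_eq_sq_mul (h₁ V G h : ℝ) :
    potential h₁ V G h = h₁ ^ 2 * potential 1 V G h := by
  unfold potential; ring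

/-- The FreeGrad iterate keeps the sum of its loss and its potential from increasing. -/
theorem potential_step {h₁ V G h g : ℝ} (hh : 0 < h) (hV : 0 < V) (hg : |g| ≤ h) :
    g * freeGrad h₁ V G h + potential h₁ (V + g ^ 2) (G + g) h ≤ potential h₁ V G h := by
  -- Rescaling by `h` gives unit hint; `h₁` enters only as a factor `h₁ ^ 2`, so it may differ from
  -- `h`.
  have h1 := potential_step_unit (V := V / h ^ 2) (G := G / h) (g := g / h) (by positivity)
    (by rwa [abs_div, abs_of_pos hh, div_le_one hh])
  have s1 := freeGrad_scale hh 1 (V / h ^ 2) (G / h) 1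
  have s2 := potential_scale hh 1 (V / h ^ 2) (G / h) 1
  have s3 := potential_scale hh 1 (V / h ^ 2 + (g / h) ^ 2) (G / h + g / h) 1
  have e1 : h ^ 2 * (V / h ^ 2) = V := by field_simp
  have e2 : h * (G / h) = G := by field_simp
  have e3 : h ^ 2 * (V / h ^ 2 + (g / h) ^ 2) = V + g ^ 2 := by field_simp
  have e4 : h * (G / h + g / h) = G + g := by field_simp
  rw [e1, e2, mul_one, freeGrad_eq_sq_mul] at s1
  rw [e1, e2, mul_one, potential_eq_sq_mul] at s2
  rw [e3, e4, mul_one, potential_eq_sq_mul] at s3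
  rw [freeGrad_eq_sq_mul h₁, potential_eq_sq_mul h₁, potential_eq_sq_mul h₁ V]
  have h2 : h * (g / h * freeGrad 1 (V / h ^ 2) (G / h) 1
      + potential 1 (V / h ^ 2 + (g / h) ^ 2) (G / h + g / h) 1)
      ≤ h * potential 1 (V / h ^ 2) (G / h) 1 := by gcongr
  have h3 : g * freeGrad 1 V G h + potential 1 (V + g ^ 2) (G + g) h ≤ potential 1 V G h := by
    have : 0 < h ^ 2 := by positivity
    refine le_of_mul_le_mul_left ?_ this
    rw [mul_add, s3, s2]
    rw [mul_add, ← s1] at h2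
    have e5 : h * (g / h * (h ^ 2 * freeGrad 1 V G h)) = h ^ 2 * (g * freeGrad 1 V G h) := by
      field_simp
    rwa [e5] at h2
  calc _ = h₁ ^ 2 * (g * freeGrad 1 V G h + potential 1 (V + g ^ 2) (G + g) h) := by ring
    _ ≤ _ := by gcongr

theorem potential_antitone_hint {h₁ V G h h' : ℝ} (hV : 0 < V) (hh : 0 ≤ h) (hhh' : h ≤ h') :
    potential h₁ V G h' ≤ potential h₁ V G h := by
  unfold potential
  gcongr

/-! ### Hints, ratio sums and epochs -/

theorem hint_mono (x : ℕ → ℝ) : Monotone (hint x) :=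
  monotone_nat_of_le_succ fun _ => le_max_left _ _

theorem abs_le_hint (x : ℕ → ℝ) {t : ℕ} (ht : 1 ≤ t) : |x t| ≤ hint x t := by
  obtain ⟨s, rfl⟩ := Nat.exists_eq_add_of_le' ht
  exact le_max_right _ _

theorem hint_one (x : ℕ → ℝ) : hint x 1 = |x 1| := by
  simp [hint]

theorem hint_pos {x : ℕ → ℝ} (hx : x 1 ≠ 0) {t : ℕ} (ht : 1 ≤ t) : 0 < hint x t := by
  have := hint_mono x ht
  rw [hint_one] at this
  exact (abs_pos.2 hx).trans_le this

theorem ratioSum_succ (x : ℕ → ℝ) (t : ℕ) :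
    ratioSum x (t + 1) = ratioSum x t + |x (t + 1)| / hint x (t + 1) := by
  rw [ratioSum, ratioSum, Finset.sum_Icc_succ_top (by omega)]

theorem hint_nonneg (x : ℕ → ℝ) (t : ℕ) : 0 ≤ hint x t :=
  hint_mono x (Nat.zero_le t)

theorem ratioSum_mono (x : ℕ → ℝ) : Monotone (ratioSum x) :=
  monotone_nat_of_le_succ fun t => by
    rw [ratioSum_succ]
    have := hint_nonneg x (t + 1)
    linarith [div_nonneg (abs_nonneg (x (t + 1))) this]

theorem ratioSum_one {x : ℕ → ℝ} (hx : x 1 ≠ 0) : ratioSum x 1 = 1 := by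
  simp [ratioSum, hint_one, hx]

theorem one_le_ratioSum {x : ℕ → ℝ} (hx : x 1 ≠ 0) {t : ℕ} (ht : 1 ≤ t) : 1 ≤ ratioSum x t :=
  (ratioSum_one hx).symm.le.trans (ratioSum_mono x ht)

theorem ratioSum_nonneg (x : ℕ → ℝ) (t : ℕ) : 0 ≤ ratioSum x t := by
  have := ratioSum_mono x (Nat.zero_le t)
  simpa [ratioSum] using this

theorem ratioSum_le (x : ℕ → ℝ) (t : ℕ) : ratioSum x t ≤ t := by
  induction t with
  | zero => simp [ratioSum]
  | succ t ih =>
    rw [ratioSum_succ]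
    push_cast
    gcongr
    exact div_le_one_of_le₀ (abs_le_hint x (by omega)) (hint_nonneg x _)

theorem sum_abs_le_hint_mul_ratioSum {x : ℕ → ℝ} (hx : x 1 ≠ 0) (t : ℕ) :
    ∑ s ∈ Icc 1 t, |x s| ≤ hint x t * ratioSum x t := by
  rw [ratioSum, Finset.mul_sum]
  refine Finset.sum_le_sum fun s hs => ?_
  obtain ⟨h1, h2⟩ := Finset.mem_Icc.mp hs
  have h3 := hint_pos hx h1
  calc |x s| = hint x s * (|x s| / hint x s) := by field_simp
    _ ≤ _ := by
      gcongr
      exact hint_mono x h2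

theorem epochStart_succ_of_not {x : ℕ → ℝ} {t : ℕ}
    (h : ¬ hint x (t + 1) / hint x (epochStart x t) > ratioSum x t + 1) :
    epochStart x (t + 1) = epochStart x t := by
  rw [epochStart, if_neg h]

theorem epochStart_succ_of_gt {x : ℕ → ℝ} {t : ℕ}
    (h : hint x (t + 1) / hint x (epochStart x t) > ratioSum x t + 1) :
    epochStart x (t + 1) = t + 1 := by
  rw [epochStart, if_pos h]

theorem one_le_epochStart (x : ℕ → ℝ) (t : ℕ) : 1 ≤ epochStart x t := by
  induction t with
  | zero => exact le_rfl
  | succ t ih => rw [epochStart]; split_ifs <;> omega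

theorem epochStart_one (x : ℕ → ℝ) : epochStart x 1 = 1 := by
  rw [epochStart]; split_ifs <;> rfl

theorem epochStart_le (x : ℕ → ℝ) {t : ℕ} (ht : 1 ≤ t) : epochStart x t ≤ t := by
  induction t, ht using Nat.le_induction with
  | base => rw [epochStart_one]
  | succ t ht ih => rw [epochStart]; split_ifs <;> omega

/-- All the rounds from the start of the epoch of `t` up to `t` belong to the same epoch. -/
theorem epochStart_eq_of_mem (x : ℕ → ℝ) {s t : ℕ} (ht : 1 ≤ t) (h : epochStart x t ≤ s)
    (hst : s ≤ t) : epochStart x s = epochStart x t := by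
  induction t, ht using Nat.le_induction with
  | base =>
    have := one_le_epochStart x 1
    rw [show s = 1 by omega]
  | succ t ht ih =>
    rcases Nat.lt_or_ge t s with h1 | h1
    · rw [show s = t + 1 by omega]
    · by_cases hr : hint x (t + 1) / hint x (epochStart x t) > ratioSum x t + 1
      · rw [epochStart_succ_of_gt hr] at h; omega
      · rw [epochStart_succ_of_not hr] at h ⊢
        exact ih h h1

theorem epochStart_epochStart (x : ℕ → ℝ) {t : ℕ} (ht : 1 ≤ t) :
    epochStart x (epochStart x t) = epochStart x t :=
  epochStart_eq_of_mem x ht le_rfl (epochStart_le x ht)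

/-- Within an epoch the hint has grown by a factor of at most `B_t`. -/
theorem hint_le_mul_ratioSum {x : ℕ → ℝ} (hx : x 1 ≠ 0) {t : ℕ} (ht : 1 ≤ t) :
    hint x t ≤ hint x (epochStart x t) * ratioSum x t := by
  induction t, ht using Nat.le_induction with
  | base => rw [epochStart_one, ratioSum_one hx, mul_one]
  | succ t ht ih =>
    by_cases hr : hint x (t + 1) / hint x (epochStart x t) > ratioSum x t + 1
    · rw [epochStart_succ_of_gt hr]
      exact le_mul_of_one_le_right (hint_nonneg x _) (one_le_ratioSum hx (by omega))
    · rw [epochStart_succ_of_not hr]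
      have hτ := hint_pos hx (one_le_epochStart x t)
      rcases le_total |x (t + 1)| (hint x t) with h | h
      · have : hint x (t + 1) = hint x t := max_eq_left h
        rw [this]
        refine ih.trans ?_
        gcongr
        exact ratioSum_mono x (Nat.le_succ t)
      -- A new maximum makes the new ratio equal to `1`, so the failed restart test is exactly the
      -- claim with `B_{t+1} = B_t + 1`.
      · have e : hint x (t + 1) = |x (t + 1)| := max_eq_right h
        have hp := hint_pos hx (show 1 ≤ t + 1 by omega)
        rw [not_lt, div_le_iff₀ hτ] at hr
        rw [ratioSum_succ, ← e, div_self hp.ne', mul_comm]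
        exact hr

/-- What a restart in round `t + 1` entails. -/
theorem restart {x : ℕ → ℝ} (hx : x 1 ≠ 0) {t : ℕ} (ht : 1 ≤ t)
    (h : epochStart x (t + 1) = t + 1) :
    hint x (epochStart x t) * (ratioSum x t + 1) < hint x (t + 1) ∧
      ratioSum x (t + 1) = ratioSum x t + 1 := by
  have hr : hint x (t + 1) / hint x (epochStart x t) > ratioSum x t + 1 := by
    by_contra hr
    rw [epochStart_succ_of_not hr] at h
    have := epochStart_le x ht
    omega
  have hτ := hint_pos hx (one_le_epochStart x t)
  rw [gt_iff_lt, lt_div_iff₀ hτ, mul_comm] at hr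
  refine ⟨hr, ?_⟩
  -- Within the old epoch the hint is at most `h_τ B_t`, so passing the test forces a strictly new
  -- maximum.
  have h1 : hint x t < hint x (t + 1) :=
    (hint_le_mul_ratioSum hx ht).trans_lt (lt_of_le_of_lt (by gcongr; linarith) hr)
  have e : hint x (t + 1) = |x (t + 1)| := by
    rcases le_total |x (t + 1)| (hint x t) with h | h
    · exact absurd (max_eq_left h : hint x (t + 1) = hint x t) h1.ne'
    · exact max_eq_right h
  rw [ratioSum_succ, ← e, div_self (hint_pos hx (by omega)).ne']

/-! ### Losses of epochs and their sum -/

/-- The FreeGrad potential of the epoch that contains round `t`, after round `t`, in the scale of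
the outputs. -/
noncomputable def epochPotential (x g : ℕ → ℝ) (t : ℕ) : ℝ :=
  potential (hint x (epochStart x t))
    (hint x (epochStart x t) ^ 2 + ∑ s ∈ Icc (epochStart x t) t, |g s| ^ 2)
    (∑ s ∈ Icc (epochStart x t) t, g s) (hint x t)
      * (hint x (epochStart x t) * ratioSum x (epochStart x t))⁻¹

theorem epochPotential_nonneg (x g : ℕ → ℝ) (t : ℕ) : 0 ≤ epochPotential x g t :=
  mul_nonneg (potential_nonneg _ _ _ _)
    (inv_nonneg.2 (mul_nonneg (hint_nonneg _ _) (ratioSum_nonneg _ _)))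

/-- Telescoping of `potential_step`; between rounds the hint is raised before the next iterate is
formed, which is harmless by `potential_antitone_hint`. -/
theorem freeGrad_loss_partial_sum {x g : ℕ → ℝ} (hx : x 1 ≠ 0) {τ n : ℕ} (hτ : 1 ≤ τ)
    (hn : τ ≤ n) (hg : ∀ s ∈ Icc τ n, |g s| ≤ hint x s) :
    ∑ t ∈ Icc τ n, g t * freeGrad (hint x τ) (hint x τ ^ 2 + ∑ s ∈ Ico τ t, |g s| ^ 2)
        (∑ s ∈ Ico τ t, g s) (hint x t)
      ≤ hint x τ - potential (hint x τ) (hint x τ ^ 2 + ∑ s ∈ Icc τ n, |g s| ^ 2)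
        (∑ s ∈ Icc τ n, g s) (hint x n) := by
  have hh := hint_pos hx hτ
  have hV : ∀ A : Finset ℕ, 0 < hint x τ ^ 2 + ∑ s ∈ A, |g s| ^ 2 := fun A => by positivity
  have step : ∀ t, τ ≤ t → |g t| ≤ hint x t →
      g t * freeGrad (hint x τ) (hint x τ ^ 2 + ∑ s ∈ Ico τ t, |g s| ^ 2)
        (∑ s ∈ Ico τ t, g s) (hint x t)
      + potential (hint x τ) (hint x τ ^ 2 + ∑ s ∈ Icc τ t, |g s| ^ 2)
        (∑ s ∈ Icc τ t, g s) (hint x t)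
      ≤ potential (hint x τ) (hint x τ ^ 2 + ∑ s ∈ Ico τ t, |g s| ^ 2)
        (∑ s ∈ Ico τ t, g s) (hint x t) := by
    intro t ht hgt
    have := potential_step (h₁ := hint x τ) (G := ∑ s ∈ Ico τ t, g s)
      (hint_pos hx (hτ.trans ht)) (hV (Ico τ t)) hgt
    rw [← Finset.Ico_insert_right ht, Finset.sum_insert (by simp), Finset.sum_insert (by simp),
      sq_abs]
    convert this using 3 <;> ring
  induction n, hn using Nat.le_induction with
  | base =>
    have h1 := step τ le_rfl (hg τ (by simp))
    have h2 : potential (hint x τ) (hint x τ ^ 2 + ∑ s ∈ Ico τ τ, |g s| ^ 2)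
        (∑ s ∈ Ico τ τ, g s) (hint x τ) = hint x τ := by
      simp only [potential, Ico_self, sum_empty, add_zero, Real.sqrt_sq hh.le, abs_zero]
      norm_num
      field_simp
    rw [h2] at h1
    rw [Finset.Icc_self, Finset.sum_singleton]
    rw [Finset.Icc_self] at h1
    linarith
  | succ n hn ih =>
    have h1 := step (n + 1) (by omega) (hg (n + 1) (Finset.right_mem_Icc.2 (by omega)))
    have h2 := ih fun s hs =>
      hg s (Finset.Icc_subset_Icc_right (Nat.le_succ n) hs)
    have e : Ico τ (n + 1) = Icc τ n := by ext; rw [mem_Ico, mem_Icc]; omega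
    rw [Finset.sum_Icc_succ_top (by omega), e]
    rw [e] at h1
    have h3 := potential_antitone_hint (h₁ := hint x τ) (G := ∑ s ∈ Icc τ n, g s) (hV (Icc τ n))
      (hint_nonneg x n) (hint_mono x (Nat.le_succ n))
    linarith

/-- The loss in the epoch of round `n`, up to round `n`. -/
theorem epoch_loss_le {x g : ℕ → ℝ} (hx : x 1 ≠ 0) {n : ℕ} (hn : 1 ≤ n)
    (hg : ∀ s ∈ Icc 1 n, |g s| ≤ hint x s) :
    ∑ t ∈ Icc (epochStart x n) n, g t * freeRange x g t
      ≤ 1 / ratioSum x (epochStart x n) - epochPotential x g n := by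
  have hτ := one_le_epochStart x n
  have hB := one_le_ratioSum hx hτ
  have hh := hint_pos hx hτ
  have h1 := freeGrad_loss_partial_sum hx hτ (epochStart_le x hn) (g := g)
    fun s hs => hg s (by simp at hs ⊢; omega)
  have h2 : ∑ t ∈ Icc (epochStart x n) n, g t * freeRange x g t
      = (∑ t ∈ Icc (epochStart x n) n, g t * freeGrad (hint x (epochStart x n))
          (hint x (epochStart x n) ^ 2 + ∑ s ∈ Ico (epochStart x n) t, |g s| ^ 2)
        (∑ s ∈ Ico (epochStart x n) t, g s) (hint x t))
        * (hint x (epochStart x n) * ratioSum x (epochStart x n))⁻¹ := by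
    rw [Finset.sum_mul]
    refine Finset.sum_congr rfl fun t ht => ?_
    rw [Finset.mem_Icc] at ht
    simp only [freeRange]
    rw [epochStart_eq_of_mem x hn ht.1 ht.2, mul_assoc]
  rw [h2, epochPotential]
  have h3 : (0 : ℝ) ≤ (hint x (epochStart x n) * ratioSum x (epochStart x n))⁻¹ := by positivity
  have h4 := mul_le_mul_of_nonneg_right h1 h3
  have h5 : 1 / ratioSum x (epochStart x n) = hint x (epochStart x n)
      * (hint x (epochStart x n) * ratioSum x (epochStart x n))⁻¹ := by field_simp
  rw [h5]
  linarith

theorem sum_Icc_split {f : ℕ → ℝ} {m n : ℕ} (hmn : m ≤ n) :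
    ∑ t ∈ Icc 1 n, f t = ∑ t ∈ Icc 1 m, f t + ∑ t ∈ Icc (m + 1) n, f t := by
  rw [← Finset.sum_union]
  · congr 1; ext; simp; omega
  · rw [Finset.disjoint_left]; intro a; simp; omega

/-- The total loss, in terms of the potentials at the end of the current and the previous
epoch. -/
theorem total_loss_le {x g : ℕ → ℝ} (hx : x 1 ≠ 0) {n : ℕ} (hn : 1 ≤ n)
    (hg : ∀ s ∈ Icc 1 n, |g s| ≤ hint x s) :
    ∑ t ∈ Icc 1 n, g t * freeRange x g t
      ≤ 1 + Real.log (ratioSum x n) - epochPotential x g n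
        - (if epochStart x n = 1 then 0 else epochPotential x g (epochStart x n - 1)) := by
  -- With `B` taken at the epoch's start, the induction can jump from an epoch to the last round `m`
  -- of the previous one.
  suffices h : ∑ t ∈ Icc 1 n, g t * freeRange x g t
      ≤ 1 + Real.log (ratioSum x (epochStart x n)) - epochPotential x g n
        - (if epochStart x n = 1 then 0 else epochPotential x g (epochStart x n - 1)) by
    have h1 := one_le_ratioSum hx (one_le_epochStart x n)
    have h2 := Real.log_le_log (by linarith) (ratioSum_mono x (epochStart_le x hn))
    linarith
  induction n using Nat.strong_induction_on with
  | _ n ih =>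
    have hl := epoch_loss_le hx hn hg
    by_cases h1 : epochStart x n = 1
    · rw [if_pos h1]
      rw [h1, ratioSum_one hx] at hl
      rw [h1, ratioSum_one hx, Real.log_one]
      linarith
    · rw [if_neg h1]
      have hτ := one_le_epochStart x n
      have hτn := epochStart_le x hn
      obtain ⟨m, hm⟩ := Nat.exists_eq_add_of_le' hτ
      have hm1 : 1 ≤ m := by omega
      have h2 := ih m (by omega) hm1 fun s hs => hg s (by simp at hs ⊢; omega)
      have hr := (restart hx hm1 (by rw [← hm, epochStart_epochStart x hn])).2
      rw [hm] at hl ⊢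
      rw [sum_Icc_split (show m ≤ n by omega), Nat.add_sub_cancel]
      have hBm := one_le_ratioSum hx hm1
      have h3 : (0 : ℝ) ≤ if epochStart x m = 1 then 0
          else epochPotential x g (epochStart x m - 1) := by
        split_ifs
        exacts [le_rfl, epochPotential_nonneg _ _ _]
      have h4 : Real.log (ratioSum x (epochStart x m)) ≤ Real.log (ratioSum x m) :=
        Real.log_le_log (by linarith [one_le_ratioSum hx (one_le_epochStart x m)])
          (ratioSum_mono x (epochStart_le x hm1))
      -- Since `B_{m+1} = B_m + 1`, the left side is `1 - B_m / B_{m+1}`.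
      have h5 : 1 / ratioSum x (m + 1)
          ≤ Real.log (ratioSum x (m + 1)) - Real.log (ratioSum x m) := by
        rw [← Real.log_div (by rw [hr]; positivity) (by positivity)]
        refine le_trans (le_of_eq ?_) (Real.one_sub_inv_le_log_of_pos (by rw [hr]; positivity))
        rw [hr]
        field_simp
        ring
      linarith

/-! ### The potential against the comparator -/

theorem log_le_div_add_log {u k : ℝ} (hu : 0 < u) (hk : 0 < k) :
    Real.log u ≤ u / k + Real.log k - 1 := by
  have := Real.log_le_sub_one_of_pos (div_pos hu hk)
  rw [Real.log_div hu.ne' hk.ne'] at this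
  linarith

/-- The regime where `h` dominates, with `u = G / h`: the right side is at least `u / 2 - 1`, and
the tangent to `log` at `8` stays below that. -/
theorem add_log_le_of_large {l u : ℝ} (hl : 0 ≤ l) (hu : 7 * (l + 3 / 2 * Real.log 2) ≤ u) :
    l + Real.log u ≤ u ^ 2 / (4 + 2 * u) := by
  have h2 := Real.log_two_gt_d9
  have h2' := Real.log_two_lt_d9
  have hu0 : 7 < u := by linarith
  have h1 := log_le_div_add_log (u := u) (k := 8) (by linarith) (by norm_num)
  rw [show (8 : ℝ) = 2 ^ 3 by norm_num, Real.log_pow] at h1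
  norm_num at h1
  rw [le_div_iff₀ (by linarith)]
  have h3 : l + Real.log u ≤ u / 2 - 1 := by linarith
  nlinarith

theorem quadratic_dominates {p q r : ℝ} (hq : 1.66 ≤ q) (hp0 : 0 ≤ p) (hp : p ≤ 1)
    (h : q + p * (7 / 4 * q ^ 2 + 4.8) ≤ r) :
    (1 + p ^ 2 + p * r) * (q ^ 2 / 2 + r / 2 + 0.08) ≤ r ^ 2 := by
  have hr : q ≤ r := by nlinarith
  have e : 0.4 ≤ 5 / 7 * r ^ 2 + 2 / 7 * r * q - q ^ 2 / 2 - 0.5 * r - 0.08 := by nlinarith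
  have e1 : (r - q) * 1.1 ≤ 3 / 14 * r ^ 2 + 2 / 7 * r * q - q ^ 2 / 2 := by nlinarith
  have e2 : p * (4.8 * p) ≤ p * (r - q) := by gcongr; nlinarith
  have e3 := mul_le_mul_of_nonneg_left h (by linarith : 0 ≤ r)
  have e4 := mul_le_mul_of_nonneg_left h hp0
  have e5 := mul_le_mul_of_nonneg_left e1 hp0
  have e6 := mul_le_mul_of_nonneg_left e (sub_nonneg.2 hp)
  have e7 : p ^ 2 ≤ p := by nlinarith
  have e8 : p ^ 2 * r ≤ p * r := by gcongr; nlinarith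
  nlinarith

/-- The regime where `√S` dominates, with `p = h / √S` and `r = G / √S`. The tangent to `log` at `4`
and `l = q ^ 2 / 4 - log 2 / 2` turn it into `quadratic_dominates`, whose decimals are roundings of
expressions in `log 2`. -/
theorem add_log_le_of_mixed {l p r : ℝ} (hl : Real.log 2 / 2 ≤ l) (hp0 : 0 ≤ p) (hp : p ≤ 1)
    (hr : 7 * p * (l + 3 / 2 * Real.log 2) + Real.sqrt (2 * (2 * l + Real.log 2)) ≤ r) :
    l + Real.log r ≤ r ^ 2 / (2 + 2 * p ^ 2 + 2 * p * r) := by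
  have h2 := Real.log_two_gt_d9
  have h2' := Real.log_two_lt_d9
  set q := Real.sqrt (2 * (2 * l + Real.log 2)) with hq
  have hq2 : q ^ 2 = 2 * (2 * l + Real.log 2) := Real.sq_sqrt (by linarith)
  have hq1 : 1.66 ≤ q := Real.le_sqrt_of_sq_le (by norm_num; linarith)
  have hqr : q + p * (7 / 4 * q ^ 2 + 4.8) ≤ r := by
    refine le_trans ?_ hr
    rw [hq2]
    nlinarith
  have hr0 : 0 < r := by nlinarith
  have h1 := log_le_div_add_log (u := r) (k := 4) hr0 (by norm_num)
  rw [show (4 : ℝ) = 2 ^ 2 by norm_num, Real.log_pow] at h1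
  norm_num at h1
  have h3 := quadratic_dominates hq1 hp0 hp hqr
  rw [le_div_iff₀ (by positivity)]
  have h4 : l + Real.log r ≤ (q ^ 2 / 2 + r / 2 + 0.08) / 2 := by linarith
  have h5 := mul_le_mul_of_nonneg_right h4 (by positivity : 0 ≤ 2 + 2 * p ^ 2 + 2 * p * r)
  linarith

/-- Either the sum `G` of the sub-gradients is small, or the potential dominates `w * G`. -/
theorem comparator_sub_potential_le {w h' h S G B Z : ℝ} (hw : 0 ≤ w) (hh' : 0 < h')
    (hh : h' ≤ h) (hS : 0 ≤ S) (hB : 0 < B) (hZ : 0 < Z)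
    (hl : Real.log 2 / 2 ≤ Real.log Z)
    (ha : Real.sqrt 2 * (w * G * B) ≤ Z)
    (hb : Real.sqrt 2 * (w * Real.sqrt S * B * (h / h')) ≤ Z)
    (hc : w * Real.sqrt S * B * (Real.sqrt (h' ^ 2 + S) / h') ≤ Z) :
    w * G - h' / (B * Real.sqrt (h' ^ 2 + S))
        * Real.exp (G ^ 2 / (2 * (h' ^ 2 + S) + 2 * h * G))
      ≤ w * (7 * h * (Real.log Z + 3 / 2 * Real.log 2)
        + Real.sqrt (2 * S * (2 * Real.log Z + Real.log 2))) := by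
  set l := Real.log Z with hld
  have h2 := Real.log_two_gt_d9
  have hh0 : 0 < h := by linarith
  have hV : 0 < h' ^ 2 + S := by positivity
  have hsV := Real.sqrt_pos.2 hV
  rcases le_or_gt G (7 * h * (l + 3 / 2 * Real.log 2)
    + Real.sqrt (2 * S * (2 * l + Real.log 2))) with hsmall | hlarge
  · have h1 : 0 ≤ h' / (B * Real.sqrt (h' ^ 2 + S))
        * Real.exp (G ^ 2 / (2 * (h' ^ 2 + S) + 2 * h * G)) := by positivity
    have := mul_le_mul_of_nonneg_left hsmall hw
    linarith
  have hrhs : 0 ≤ w * (7 * h * (l + 3 / 2 * Real.log 2)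
        + Real.sqrt (2 * S * (2 * l + Real.log 2))) := by
    have : 0 ≤ l + 3 / 2 * Real.log 2 := by linarith
    positivity
  suffices hmain : w * G * (B * (Real.sqrt (h' ^ 2 + S) / h'))
      ≤ Real.exp (G ^ 2 / (2 * (h' ^ 2 + S) + 2 * h * G)) by
    have h1 : w * G = h' / (B * Real.sqrt (h' ^ 2 + S))
        * (w * G * (B * (Real.sqrt (h' ^ 2 + S) / h'))) := by field_simp
    have h3 := mul_le_mul_of_nonneg_left hmain
      (by positivity : 0 ≤ h' / (B * Real.sqrt (h' ^ 2 + S)))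
    rw [← h1] at h3
    linarith
  have hG1 : 7 * h * (l + 3 / 2 * Real.log 2) < G :=
    lt_of_le_of_lt (le_add_of_nonneg_right (Real.sqrt_nonneg _)) hlarge
  have hu : 7 * (l + 3 / 2 * Real.log 2) ≤ G / h := by
    rw [le_div_iff₀ hh0]; linarith
  have hu1 : 1 ≤ G / h := by linarith
  have hG0 : 0 < G := by
    have : 0 ≤ 7 * h * (l + 3 / 2 * Real.log 2) := by
      have : 0 ≤ l + 3 / 2 * Real.log 2 := by linarith
      positivity
    linarith
  have h'sq : h' ^ 2 ≤ h ^ 2 := pow_le_pow_left₀ hh'.le hh 2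
  have hE1 : S ≤ h ^ 2 → l + Real.log (G / h) ≤ G ^ 2 / (2 * (h' ^ 2 + S) + 2 * h * G) := by
    intro hSh
    refine (add_log_le_of_large (by linarith) hu).trans ?_
    have e : (G / h) ^ 2 / (4 + 2 * (G / h)) = G ^ 2 / (2 * (h ^ 2 + h ^ 2) + 2 * h * G) := by
      field_simp
      ring
    rw [e]
    gcongr
  have exp_of_log : ∀ {A : ℝ}, 0 < A → l + Real.log A ≤ G ^ 2 / (2 * (h' ^ 2 + S) + 2 * h * G) →
      Z * A ≤ Real.exp (G ^ 2 / (2 * (h' ^ 2 + S) + 2 * h * G)) := by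
    intro A hA h3
    rw [← Real.exp_log (mul_pos hZ hA), Real.log_mul hZ.ne' hA.ne', Real.exp_le_exp]
    exact h3
  -- Three regimes: `S ≤ h' ^ 2`, `h' ^ 2 ≤ S ≤ h ^ 2` and `h ^ 2 ≤ S` use `ha`, `hb` and `hc`
  -- respectively.
  rcases le_total S (h' ^ 2) with hS1 | hS1
  · have h3 := exp_of_log (by linarith) (hE1 (hS1.trans h'sq))
    have h4 : Real.sqrt (h' ^ 2 + S) / h' ≤ Real.sqrt 2 := by
      rw [div_le_iff₀ hh', Real.sqrt_le_left (by positivity), mul_pow, Real.sq_sqrt (by norm_num)]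
      linarith
    calc _ ≤ w * G * (B * Real.sqrt 2) := by gcongr
      _ = Real.sqrt 2 * (w * G * B) := by ring
      _ ≤ Z := ha
      _ ≤ Z * (G / h) := le_mul_of_one_le_right hZ.le hu1
      _ ≤ _ := h3
  · have hS0 : 0 < S := lt_of_lt_of_le (by positivity) hS1
    have hsS := Real.sqrt_pos.2 hS0
    rcases le_total S (h ^ 2) with hS2 | hS2
    · have h3 := exp_of_log (by linarith) (hE1 hS2)
      have h4 : Real.sqrt (h' ^ 2 + S) ≤ Real.sqrt 2 * Real.sqrt S := by
        rw [← Real.sqrt_mul (by norm_num)]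
        exact Real.sqrt_le_sqrt (by linarith)
      calc _ ≤ w * G * (B * (Real.sqrt 2 * Real.sqrt S / h')) := by gcongr
        _ = Real.sqrt 2 * (w * Real.sqrt S * B * (h / h')) * (G / h) := by field_simp
        _ ≤ Z * (G / h) := by gcongr
        _ ≤ _ := h3
    · set p := h / Real.sqrt S with hp
      have hp0 : 0 ≤ p := by positivity
      have hp1 : p ≤ 1 := by
        rw [hp, div_le_one hsS]
        exact Real.le_sqrt_of_sq_le hS2
      have hr : 7 * p * (l + 3 / 2 * Real.log 2) + Real.sqrt (2 * (2 * l + Real.log 2))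
          ≤ G / Real.sqrt S := by
        rw [le_div_iff₀ hsS]
        have e1 : Real.sqrt (2 * S * (2 * l + Real.log 2))
            = Real.sqrt (2 * (2 * l + Real.log 2)) * Real.sqrt S := by
          rw [← Real.sqrt_mul (by linarith)]; congr 1; ring
        have e2 : p * Real.sqrt S = h := by rw [hp]; field_simp
        rw [e1] at hlarge
        calc _ = 7 * (p * Real.sqrt S) * (l + 3 / 2 * Real.log 2)
              + Real.sqrt (2 * (2 * l + Real.log 2)) * Real.sqrt S := by ring
          _ ≤ G := by rw [e2]; exact hlarge.le
      have h3 : l + Real.log (G / Real.sqrt S) ≤ G ^ 2 / (2 * (h' ^ 2 + S) + 2 * h * G) := by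
        refine (add_log_le_of_mixed hl hp0 hp1 hr).trans ?_
        have e : (G / Real.sqrt S) ^ 2 / (2 + 2 * p ^ 2 + 2 * p * (G / Real.sqrt S))
            = G ^ 2 / (2 * (h ^ 2 + Real.sqrt S ^ 2) + 2 * h * G) := by
          rw [hp]
          field_simp
          ring
        rw [e, Real.sq_sqrt hS]
        gcongr
      calc _ = w * Real.sqrt S * B * (Real.sqrt (h' ^ 2 + S) / h') * (G / Real.sqrt S) := by
            field_simp
        _ ≤ Z * (G / Real.sqrt S) := by gcongr
        _ ≤ _ := exp_of_log (by positivity) h3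

/-! ### The linearized regret bound -/

theorem sum_ratioSum_sq_ge {x : ℕ → ℝ} (hx : x 1 ≠ 0) (T : ℕ) :
    (T : ℝ) ≤ ∑ t ∈ Icc 1 T, ratioSum x t ^ 2 := by
  have h : ∀ t ∈ Icc 1 T, (1 : ℝ) ≤ ratioSum x t ^ 2 := fun t ht =>
    one_le_pow₀ (one_le_ratioSum hx (Finset.mem_Icc.1 ht).1)
  simpa using Finset.card_nsmul_le_sum (Icc 1 T) _ 1 h

theorem ratioSum_sq_le_sum (x : ℕ → ℝ) {n T : ℕ} (hn : 1 ≤ n) (hnT : n ≤ T) :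
    ratioSum x n ^ 2 ≤ ∑ t ∈ Icc 1 T, ratioSum x t ^ 2 :=
  Finset.single_le_sum (f := fun t => ratioSum x t ^ 2) (fun _ _ => sq_nonneg _)
    (Finset.mem_Icc.2 ⟨hn, hnT⟩)

theorem ratioConst_nonneg (x : ℕ → ℝ) (T : ℕ) : 0 ≤ ratioConst x T := by
  unfold ratioConst; positivity

theorem variance_nonneg (x δ : ℕ → ℝ) (T : ℕ) : 0 ≤ variance x δ T := by
  unfold variance; positivity

theorem sum_sq_le_variance (x δ : ℕ → ℝ) {T : ℕ} {A : Finset ℕ} (hA : A ⊆ Icc 1 T) :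
    ∑ s ∈ A, |x s * δ s| ^ 2 ≤ variance x δ T := by
  have h1 : ∑ s ∈ A, |x s * δ s| ^ 2 ≤ ∑ s ∈ Icc 1 T, |x s * δ s| ^ 2 :=
    Finset.sum_le_sum_of_subset_of_nonneg hA fun _ _ _ => by positivity
  have h2 : ∑ s ∈ Icc 1 T, |x s * δ s| ^ 2 = ∑ t ∈ Icc 1 T, δ t ^ 2 * x t ^ 2 :=
    Finset.sum_congr rfl fun s _ => by rw [sq_abs]; ring
  have h3 := sq_nonneg |x 1|
  rw [variance]
  linarith

theorem sq_abs_sum_le {g : ℕ → ℝ} {T : ℕ} {A : Finset ℕ} (hA : A ⊆ Icc 1 T) :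
    |∑ s ∈ A, g s| ^ 2 ≤ T * ∑ s ∈ A, |g s| ^ 2 := by
  have h1 := sq_sum_le_card_mul_sum_sq (s := A) (f := g)
  have h2 : (#A : ℝ) ≤ T := by
    have := Finset.card_le_card hA
    rw [Nat.card_Icc, Nat.add_sub_cancel] at this
    exact_mod_cast this
  rw [sq_abs]
  simp only [sq_abs]
  exact h1.trans (by gcongr)

/-- The sum of sub-gradients over any set of rounds, on the scale of the logarithmic terms. -/
theorem sqrt_two_mul_abs_sum_le {x δ : ℕ → ℝ} (hx : x 1 ≠ 0) {T : ℕ} {A : Finset ℕ}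
    (hA : A ⊆ Icc 1 T) {w B : ℝ} (hw : 0 ≤ w) (hB : 0 ≤ B) (hBT : B ≤ ratioSum x T) :
    Real.sqrt 2 * (w * |∑ s ∈ A, x s * δ s| * B)
      ≤ w * Real.sqrt (variance x δ T * ratioConst x T) := by
  rw [show Real.sqrt 2 * (w * |∑ s ∈ A, x s * δ s| * B)
    = w * (Real.sqrt 2 * |∑ s ∈ A, x s * δ s| * B) by ring]
  refine mul_le_mul_of_nonneg_left (Real.le_sqrt_of_sq_le ?_) hw
  rw [mul_pow, mul_pow, Real.sq_sqrt (by norm_num)]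
  have h1 := sq_abs_sum_le (g := fun s => x s * δ s) hA
  have h2 := sum_sq_le_variance x δ hA
  have h3 := sum_ratioSum_sq_ge hx T
  have h0 := variance_nonneg x δ T
  calc _ ≤ 2 * (T * variance x δ T) * ratioSum x T ^ 2 := by
        gcongr
        exact h1.trans (by gcongr)
    _ = variance x δ T * (2 * ratioSum x T ^ 2 * T) := by ring
    _ ≤ _ := by rw [ratioConst]; gcongr

/-- Regret minus potential within one epoch, when the comparator is large. -/
theorem epoch_comparator_le {x δ : ℕ → ℝ} (hx : x 1 ≠ 0) {n T : ℕ} (hn : 1 ≤ n) (hnT : n ≤ T)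
    (hδ : ∀ t ∈ Icc 1 T, |δ t| ≤ 1) {w : ℝ} (hw : 0 ≤ w)
    (hZ : Real.sqrt 2 ≤ w * Real.sqrt (variance x δ T * ratioConst x T)) :
    w * |∑ s ∈ Icc (epochStart x n) n, x s * δ s| - epochPotential x (fun s => x s * δ s) n
      ≤ w * (7 * hint x T * (Real.log (w * Real.sqrt (variance x δ T * ratioConst x T))
          + 3 / 2 * Real.log 2)
        + Real.sqrt (2 * (∑ s ∈ Icc (epochStart x n) n, |x s * δ s| ^ 2)
          * (2 * Real.log (w * Real.sqrt (variance x δ T * ratioConst x T)) + Real.log 2))) := by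
  set Z := w * Real.sqrt (variance x δ T * ratioConst x T) with hZd
  set τ := epochStart x n with hτd
  have hτ : 1 ≤ τ := one_le_epochStart x n
  have hτn : τ ≤ n := epochStart_le x hn
  set S := ∑ s ∈ Icc τ n, |x s * δ s| ^ 2 with hSd
  have hA : Icc τ n ⊆ Icc 1 T := Finset.Icc_subset_Icc hτ hnT
  have hS : 0 ≤ S := by positivity
  have hSV : S ≤ variance x δ T := sum_sq_le_variance x δ hA
  have h'0 : 0 < hint x τ := hint_pos hx hτ
  have hB1 : 1 ≤ ratioSum x τ := one_le_ratioSum hx hτ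
  have hBT : ratioSum x τ ≤ ratioSum x T := ratioSum_mono x (hτn.trans hnT)
  have h2 : (0 : ℝ) < Real.sqrt 2 := by positivity
  have hZ0 : 0 < Z := h2.trans_le hZ
  have hl : Real.log 2 / 2 ≤ Real.log Z := by
    rw [← Real.log_sqrt (by norm_num)]
    exact Real.log_le_log h2 hZ
  have hV0 := variance_nonneg x δ T
  have ha := sqrt_two_mul_abs_sum_le (δ := δ) hx hA hw (zero_le_one.trans hB1) hBT
  have hgrow : ∀ s, τ ≤ s → s ≤ n → hint x s / hint x τ ≤ ratioSum x s := fun s h1 h3 => by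
    rw [div_le_iff₀ h'0, mul_comm]
    have := hint_le_mul_ratioSum hx (hτ.trans h1)
    rwa [epochStart_eq_of_mem x hn h1 h3] at this
  have hb : Real.sqrt 2 * (w * Real.sqrt S * ratioSum x τ * (hint x n / hint x τ)) ≤ Z := by
    rw [show Real.sqrt 2 * (w * Real.sqrt S * ratioSum x τ * (hint x n / hint x τ))
      = w * (Real.sqrt 2 * Real.sqrt S * ratioSum x τ * (hint x n / hint x τ)) by ring, hZd]
    refine mul_le_mul_of_nonneg_left (Real.le_sqrt_of_sq_le ?_) hw
    rw [mul_pow, mul_pow, mul_pow, Real.sq_sqrt (by norm_num), Real.sq_sqrt hS]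
    have h3 := hgrow n hτn le_rfl
    have h4 := ratioSum_sq_le_sum x hn hnT
    have h5 := hint_nonneg x n
    calc _ ≤ 2 * variance x δ T * ratioSum x T ^ 2 * ratioSum x n ^ 2 := by gcongr
      _ = variance x δ T * (2 * ratioSum x T ^ 2 * ratioSum x n ^ 2) := by ring
      _ ≤ _ := by rw [ratioConst]; gcongr
  -- Each `|g_s| / h_τ` is at most `B_s`, which is where the sum of squares in `c_T` comes from; the
  -- factor `2` absorbs the initial `h_τ ^ 2`.
  have hVS : (hint x τ ^ 2 + S) / hint x τ ^ 2 ≤ 2 * ∑ t ∈ Icc 1 T, ratioSum x t ^ 2 := by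
    have h3 : S / hint x τ ^ 2 ≤ ∑ t ∈ Icc 1 T, ratioSum x t ^ 2 := by
      rw [hSd, Finset.sum_div]
      refine le_trans (Finset.sum_le_sum fun s hs => ?_)
        (Finset.sum_le_sum_of_subset_of_nonneg hA fun _ _ _ => sq_nonneg _)
      rw [← div_pow]
      have hs' := Finset.mem_Icc.1 hs
      refine pow_le_pow_left₀ (by positivity) (le_trans ?_ (hgrow s hs'.1 hs'.2)) 2
      gcongr
      rw [abs_mul]
      exact (mul_le_of_le_one_right (abs_nonneg _) (hδ s (hA hs))).trans
        (abs_le_hint x (hτ.trans hs'.1))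
    have h4 := sum_ratioSum_sq_ge hx T
    have h5 : (1 : ℝ) ≤ T := by exact_mod_cast hn.trans hnT
    rw [add_div, div_self (by positivity)]
    linarith
  have hc : w * Real.sqrt S * ratioSum x τ * (Real.sqrt (hint x τ ^ 2 + S) / hint x τ) ≤ Z := by
    rw [show w * Real.sqrt S * ratioSum x τ * (Real.sqrt (hint x τ ^ 2 + S) / hint x τ)
      = w * (Real.sqrt S * ratioSum x τ * (Real.sqrt (hint x τ ^ 2 + S) / hint x τ)) by ring, hZd]
    refine mul_le_mul_of_nonneg_left (Real.le_sqrt_of_sq_le ?_) hw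
    rw [mul_pow, mul_pow, div_pow, Real.sq_sqrt hS, Real.sq_sqrt (by positivity)]
    calc _ ≤ variance x δ T * ratioSum x T ^ 2 * (2 * ∑ t ∈ Icc 1 T, ratioSum x t ^ 2) := by
          gcongr
      _ = _ := by rw [ratioConst]; ring
  have key := comparator_sub_potential_le (G := |∑ s ∈ Icc τ n, x s * δ s|) hw h'0
    (hint_mono x hτn) hS (by linarith) hZ0 hl ha hb hc
  have e : epochPotential x (fun s => x s * δ s) n
      = hint x τ / (ratioSum x τ * Real.sqrt (hint x τ ^ 2 + S))
        * Real.exp (|∑ s ∈ Icc τ n, x s * δ s| ^ 2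
          / (2 * (hint x τ ^ 2 + S) + 2 * hint x n * |∑ s ∈ Icc τ n, x s * δ s|)) := by
    have : 0 < Real.sqrt (hint x τ ^ 2 + S) := Real.sqrt_pos.2 (by positivity)
    unfold epochPotential potential
    simp only [← hτd, ← hSd]
    field_simp
  rw [e]
  refine key.trans ?_
  have h6 : 0 ≤ Real.log Z + 3 / 2 * Real.log 2 := by
    have := Real.log_two_gt_d9
    linarith
  have h7 := hint_mono x hnT
  gcongr

/-- The regret bound for linearized losses whose derivatives are at most `1`. -/
theorem linearized_regret_le {x δ : ℕ → ℝ} (hx : x 1 ≠ 0) {T : ℕ} (hT : 1 ≤ T)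
    (hδ : ∀ t ∈ Icc 1 T, |δ t| ≤ 1) (w : ℝ) :
    ∑ t ∈ Icc 1 T, δ t * x t * (weight x δ t - w) ≤ regretBound x δ w T := by
  have hg : ∀ s ∈ Icc 1 T, |x s * δ s| ≤ |x s| := fun s hs => by
    rw [abs_mul]; exact mul_le_of_le_one_right (abs_nonneg _) (hδ s hs)
  have hloss := total_loss_le (g := fun s => x s * δ s) hx hT fun s hs =>
    (hg s hs).trans (abs_le_hint x (Finset.mem_Icc.1 hs).1)
  set loss := ∑ t ∈ Icc 1 T, x t * δ t * freeRange x (fun s => x s * δ s) t with hlossd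
  have hsum : ∑ t ∈ Icc 1 T, δ t * x t * (weight x δ t - w)
      = loss - w * ∑ t ∈ Icc 1 T, x t * δ t := by
    rw [hlossd, Finset.mul_sum, ← Finset.sum_sub_distrib]
    refine Finset.sum_congr rfl fun t _ => ?_
    rw [weight]
    ring
  rw [hsum]
  have hcmp : -(w * ∑ t ∈ Icc 1 T, x t * δ t) ≤ |w| * |∑ t ∈ Icc 1 T, x t * δ t| := by
    rw [← abs_mul]; exact neg_le_abs _
  have hw := abs_nonneg w
  have hV0 := variance_nonneg x δ T
  have hc0 := ratioConst_nonneg x T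
  have hh0 := hint_nonneg x T
  have hD := epochPotential_nonneg x (fun s => x s * δ s) T
  have hD' : 0 ≤ if epochStart x T = 1 then 0
      else epochPotential x (fun s => x s * δ s) (epochStart x T - 1) := by
    split_ifs
    exacts [le_rfl, epochPotential_nonneg _ _ _]
  have hp1 : 0 ≤ lnPlus (2 * |w| ^ 2 * variance x δ T * ratioConst x T) := le_max_left _ _
  have hp2 : 0 ≤ lnPlus (2 * |w| * Real.sqrt (2 * variance x δ T * ratioConst x T)) :=
    le_max_left _ _
  set Z := |w| * Real.sqrt (variance x δ T * ratioConst x T) with hZd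
  unfold regretBound
  -- For `Z ≤ √2` the comparator term is at most `1`, and the potentials are simply dropped.
  rcases le_total Z (Real.sqrt 2) with hZ | hZ
  · have h1 := sqrt_two_mul_abs_sum_le (δ := δ) hx (Finset.Subset.refl (Icc 1 T)) hw zero_le_one
      (one_le_ratioSum hx hT)
    have h2 : (0 : ℝ) < Real.sqrt 2 := by positivity
    have h3 : |w| * |∑ t ∈ Icc 1 T, x t * δ t| ≤ 1 := by
      have := h1.trans hZ
      rw [mul_one] at this
      exact le_of_mul_le_mul_left (by linarith) h2
    have h4 : 0 ≤ 2 * |w| * Real.sqrt (variance x δ T *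
      lnPlus (2 * |w| ^ 2 * variance x δ T * ratioConst x T)) := by positivity
    have h5 : 0 ≤ hint x T * |w| *
      (14 * lnPlus (2 * |w| * Real.sqrt (2 * variance x δ T * ratioConst x T)) + 1) := by
      positivity
    linarith
  · have hepoch := fun n (hn : 1 ≤ n) (hnT : n ≤ T) => epoch_comparator_le hx hn hnT hδ hw hZ
    rw [← hZd] at hepoch
    have h2 : (0 : ℝ) < Real.sqrt 2 := by positivity
    have hZ0 : 0 < Z := h2.trans_le hZ
    have e1 : 2 * Real.log Z + Real.log 2
        ≤ lnPlus (2 * |w| ^ 2 * variance x δ T * ratioConst x T) := by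
      refine le_trans (le_of_eq ?_) (le_max_right _ _)
      have : 2 * |w| ^ 2 * variance x δ T * ratioConst x T = 2 * Z ^ 2 := by
        rw [hZd, mul_pow, Real.sq_sqrt (by positivity)]; ring
      rw [this, Real.log_mul (x := 2) (y := Z ^ 2) two_ne_zero (by positivity), Real.log_pow]
      push_cast
      ring
    have e2 : Real.log Z + 3 / 2 * Real.log 2
        ≤ lnPlus (2 * |w| * Real.sqrt (2 * variance x δ T * ratioConst x T)) := by
      refine le_trans (le_of_eq ?_) (le_max_right _ _)
      have : 2 * |w| * Real.sqrt (2 * variance x δ T * ratioConst x T)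
          = 2 * Real.sqrt 2 * Z := by
        rw [hZd, mul_assoc 2 (variance x δ T), Real.sqrt_mul (by norm_num)]; ring
      rw [this, Real.log_mul (by positivity) hZ0.ne', Real.log_mul (by norm_num) h2.ne',
        Real.log_sqrt (by norm_num)]
      ring
    set L₁ := 2 * Real.log Z + Real.log 2 with hL₁
    set L₂ := Real.log Z + 3 / 2 * Real.log 2 with hL₂
    have hlog2 := Real.log_two_gt_d9
    have hlZ : Real.log 2 / 2 ≤ Real.log Z := by
      rw [← Real.log_sqrt (by norm_num)]
      exact Real.log_le_log h2 hZ
    have hL₁0 : 0 ≤ L₁ := by linarith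
    have hL₂0 : 0 ≤ L₂ := by linarith
    suffices hmain : loss + |w| * |∑ t ∈ Icc 1 T, x t * δ t|
        ≤ |w| * (2 * Real.sqrt (variance x δ T * L₁)) + hint x T * |w| * (14 * L₂ + 1)
          + (2 + Real.log (ratioSum x T)) by
      have h3 : |w| * (2 * Real.sqrt (variance x δ T * L₁))
          ≤ 2 * |w| * Real.sqrt (variance x δ T *
            lnPlus (2 * |w| ^ 2 * variance x δ T * ratioConst x T)) := by
        rw [← mul_assoc, mul_comm |w| 2]; gcongr
      have h4 : hint x T * |w| * (14 * L₂ + 1) ≤ hint x T * |w| *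
          (14 * lnPlus (2 * |w| * Real.sqrt (2 * variance x δ T * ratioConst x T)) + 1) := by
        gcongr
      linarith
    by_cases hτ1 : epochStart x T = 1
    · rw [if_pos hτ1] at hloss
      have h3 := hepoch T hT le_rfl
      rw [hτ1] at h3
      have h4 : Real.sqrt (2 * (∑ s ∈ Icc 1 T, |x s * δ s| ^ 2) * L₁)
          ≤ 2 * Real.sqrt (variance x δ T * L₁) := by
        rw [Real.sqrt_le_left (by positivity), mul_pow, Real.sq_sqrt (by positivity)]
        have := mul_le_mul_of_nonneg_right
          (sum_sq_le_variance x δ (Finset.Subset.refl (Icc 1 T))) hL₁0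
        have := mul_nonneg hV0 hL₁0
        linarith
      have h5 := mul_le_mul_of_nonneg_left h4 hw
      have h6 : 0 ≤ hint x T * |w| * (7 * L₂ + 1) := by positivity
      linarith
    · rw [if_neg hτ1] at hloss
      have hτ := one_le_epochStart x T
      have hτT := epochStart_le x hT
      obtain ⟨m, hm⟩ := Nat.exists_eq_add_of_le' hτ
      have hm1 : 1 ≤ m := by omega
      have hmT : m ≤ T := by omega
      have hσ := one_le_epochStart x m
      have hσm := epochStart_le x hm1
      obtain ⟨k, hk⟩ := Nat.exists_eq_add_of_le' hσ
      have hr := (restart hx hm1 (by rw [← hm, epochStart_epochStart x hT])).1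
      have ha := hepoch T hT le_rfl
      have hb := hepoch m hm1 hmT
      rw [hm, Nat.add_sub_cancel] at hloss
      rw [hm] at ha
      rw [hk] at hb hr
      rw [sum_Icc_split hmT, sum_Icc_split (show k ≤ m by omega)]
      have hsq : ∑ s ∈ Icc (k + 1) m, |x s * δ s| ^ 2 + ∑ s ∈ Icc (m + 1) T, |x s * δ s| ^ 2
          ≤ variance x δ T := by
        have h3 := sum_sq_le_variance x δ (Finset.Subset.refl (Icc 1 T))
        rw [sum_Icc_split hmT, sum_Icc_split (show k ≤ m by omega)] at h3
        have : 0 ≤ ∑ s ∈ Icc 1 k, |x s * δ s| ^ 2 := by positivity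
        linarith
      set Sa := ∑ s ∈ Icc (m + 1) T, |x s * δ s| ^ 2 with hSa
      set Sb := ∑ s ∈ Icc (k + 1) m, |x s * δ s| ^ 2 with hSb
      have hSa0 : 0 ≤ Sa := by positivity
      have hSb0 : 0 ≤ Sb := by positivity
      -- The two epochs are disjoint, so `Sa + Sb ≤ V_T`; then `(a + b) ^ 2 ≤ 2 * (a ^ 2 + b ^ 2)`.
      have hsqrt : Real.sqrt (2 * Sa * L₁) + Real.sqrt (2 * Sb * L₁)
          ≤ 2 * Real.sqrt (variance x δ T * L₁) := by
        refine abs_le_of_sq_le_sq' ?_ (by positivity) |>.2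
        rw [mul_pow, Real.sq_sqrt (by positivity)]
        have h3 := Real.sq_sqrt (show 0 ≤ 2 * Sa * L₁ by positivity)
        have h4 := Real.sq_sqrt (show 0 ≤ 2 * Sb * L₁ by positivity)
        have h5 := sq_nonneg (Real.sqrt (2 * Sa * L₁) - Real.sqrt (2 * Sb * L₁))
        have h6 := mul_le_mul_of_nonneg_right hsq hL₁0
        nlinarith
      -- Everything before the last two epochs is at most `h_k B_k`, which the restart at `m + 1`
      -- guarantees to be below the new hint.
      have hearly : |∑ s ∈ Icc 1 k, x s * δ s| ≤ hint x T := by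
        have h3 : |∑ s ∈ Icc 1 k, x s * δ s| ≤ ∑ s ∈ Icc 1 k, |x s| :=
          (Finset.abs_sum_le_sum_abs _ _).trans (Finset.sum_le_sum fun s hs =>
            hg s (Finset.Icc_subset_Icc_right (by omega) hs))
        have h4 := sum_abs_le_hint_mul_ratioSum hx k
        have h5 : hint x k * ratioSum x k ≤ hint x (k + 1) * (ratioSum x m + 1) := by
          have h6 := hint_mono x (Nat.le_succ k)
          have h7 := ratioSum_mono x (show k ≤ m by omega)
          have h8 := hint_nonneg x (k + 1)
          have h9 := ratioSum_nonneg x k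
          gcongr
          linarith
        have h6 := hint_mono x (show m + 1 ≤ T by omega)
        linarith
      have habs := abs_add_three (∑ s ∈ Icc 1 k, x s * δ s) (∑ s ∈ Icc (k + 1) m, x s * δ s)
        (∑ s ∈ Icc (m + 1) T, x s * δ s)
      have h3 := mul_le_mul_of_nonneg_left (habs.trans
        (add_le_add_left (add_le_add_left hearly _) _)) hw
      have h4 := mul_le_mul_of_nonneg_left hsqrt hw
      linarith

/-! ### Sub-gradients, size of the constants, scale-invariance -/

theorem abs_le_one_of_mem_subdifferential {f : ℝ → ℝ} (hf : LipschitzWith 1 f) {a δ : ℝ}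
    (hδ : δ ∈ subdifferential f a) : |δ| ≤ 1 := by
  have h : ∀ z, δ * (z - a) ≤ |z - a| := fun z => by
    have h1 := hδ z
    have h2 := hf.dist_le_mul z a
    rw [Real.dist_eq, Real.dist_eq, NNReal.coe_one, one_mul] at h2
    linarith [le_abs_self (f z - f a)]
  have h1 := h (a + 1)
  have h2 := h (a - 1)
  rw [show a + 1 - a = 1 by ring, abs_one] at h1
  rw [show a - 1 - a = -1 by ring, abs_neg, abs_one] at h2
  rw [abs_le]
  constructor <;> linarith

theorem sum_sub_sum_le_of_mem_subdifferential {ℓ : ℕ → ℝ → ℝ} {δ p z : ℕ → ℝ} {A : Finset ℕ}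
    (hδ : ∀ t ∈ A, δ t ∈ subdifferential (ℓ t) (p t)) :
    ∑ t ∈ A, ℓ t (p t) - ∑ t ∈ A, ℓ t (z t) ≤ ∑ t ∈ A, δ t * (p t - z t) := by
  rw [← Finset.sum_sub_distrib]
  refine Finset.sum_le_sum fun t ht => ?_
  linarith [hδ t ht (z t)]

theorem ratioConst_le {x : ℕ → ℝ} (T : ℕ) :
    ratioConst x T ≤ 2 * (T : ℝ) ^ 2 * ∑ t ∈ Icc 1 T, (t : ℝ) ^ 2 := by
  unfold ratioConst
  have h := ratioSum_nonneg x
  gcongr with t _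
  · exact h T
  · exact ratioSum_le x T
  · exact h t
  · exact ratioSum_le x t

theorem sum_sq_eq (T : ℕ) :
    ∑ t ∈ Icc 1 T, (t : ℝ) ^ 2 = (T : ℝ) * (T + 1) * (2 * T + 1) / 6 := by
  induction T with
  | zero => simp
  | succ T ih =>
    rw [Finset.sum_Icc_succ_top (by omega), ih]
    push_cast
    ring

theorem ratioConst_le_two_mul_pow {x : ℕ → ℝ} {T : ℕ} (hT : 1 ≤ T) :
    ratioConst x T ≤ 2 * (T : ℝ) ^ 5 := by
  refine (ratioConst_le T).trans ?_
  have h : (1 : ℝ) ≤ T := by exact_mod_cast hT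
  rw [sum_sq_eq, show 2 * (T : ℝ) ^ 5 = 2 * T ^ 2 * T ^ 3 by ring]
  gcongr
  nlinarith [mul_nonneg (by linarith : (0 : ℝ) ≤ T)
    (by nlinarith : (0 : ℝ) ≤ 4 * T ^ 2 - 3 * T - 1)]

theorem ratioConst_le_pow {x : ℕ → ℝ} {T : ℕ} (hT : 4 ≤ T) : ratioConst x T ≤ (T : ℝ) ^ 5 := by
  refine (ratioConst_le T).trans ?_
  have h : (4 : ℝ) ≤ T := by exact_mod_cast hT
  rw [sum_sq_eq, show (T : ℝ) ^ 5 = 2 * T ^ 2 * (T ^ 3 / 2) by ring]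
  refine mul_le_mul_of_nonneg_left ?_ (by positivity)
  nlinarith [mul_nonneg (by linarith : (0 : ℝ) ≤ T) (by nlinarith : (0 : ℝ) ≤ T ^ 2 - 3 * T - 1)]

theorem hint_scale {a : ℝ} (ha : 0 < a) (x : ℕ → ℝ) (t : ℕ) :
    hint (fun s => a * x s) t = a * hint x t := by
  induction t with
  | zero => simp [hint]
  | succ t ih => rw [hint, hint, ih, abs_mul, abs_of_pos ha, mul_max_of_nonneg _ _ ha.le]

theorem ratioSum_scale {a : ℝ} (ha : 0 < a) (x : ℕ → ℝ) (t : ℕ) :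
    ratioSum (fun s => a * x s) t = ratioSum x t := by
  unfold ratioSum
  refine Finset.sum_congr rfl fun s _ => ?_
  rw [hint_scale ha, abs_mul, abs_of_pos ha, mul_div_mul_left _ _ ha.ne']

theorem epochStart_scale {a : ℝ} (ha : 0 < a) (x : ℕ → ℝ) (t : ℕ) :
    epochStart (fun s => a * x s) t = epochStart x t := by
  induction t with
  | zero => rfl
  | succ t ih =>
    rw [epochStart, epochStart, ih, hint_scale ha, hint_scale ha, ratioSum_scale ha,
      mul_div_mul_left _ _ ha.ne']

/-- The FreeGrad iterate has degree `0` under scaling and the factor `1 / (h_τ B_τ)` has degree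
`-1`; the restart test sees only ratios. -/
theorem weight_scale {a : ℝ} (ha : 0 < a) (x : ℕ → ℝ) {δ δ' : ℕ → ℝ} {t : ℕ}
    (hδ : ∀ s, 1 ≤ s → s < t → δ' s = δ s) :
    a * weight (fun s => a * x s) δ' t = weight x δ t := by
  have hτ := one_le_epochStart x t
  have hs : ∀ s ∈ Ico (epochStart x t) t, δ' s = δ s := fun s hs => by
    rw [Finset.mem_Ico] at hs
    exact hδ s (by omega) hs.2
  have h1 : ∑ s ∈ Ico (epochStart x t) t, a * x s * δ' s
      = a * ∑ s ∈ Ico (epochStart x t) t, x s * δ s := by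
    rw [Finset.mul_sum]
    exact Finset.sum_congr rfl fun s h => by rw [hs s h]; ring
  have h2 : ∑ s ∈ Ico (epochStart x t) t, |a * x s * δ' s| ^ 2
      = a ^ 2 * ∑ s ∈ Ico (epochStart x t) t, |x s * δ s| ^ 2 := by
    rw [Finset.mul_sum]
    exact Finset.sum_congr rfl fun s h => by rw [hs s h, sq_abs, sq_abs]; ring
  simp only [weight, freeRange]
  rw [epochStart_scale ha, ratioSum_scale ha, hint_scale ha, hint_scale ha, h1, h2, mul_pow,
    ← mul_add, freeGrad_scale ha, mul_assoc a (hint x _), mul_inv a]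
  field_simp

theorem prediction_scale {a : ℝ} (ha : 0 < a) (x : ℕ → ℝ) {δ δ' : ℕ → ℝ} {t : ℕ}
    (hδ : ∀ s, 1 ≤ s → s < t → δ' s = δ s) :
    prediction (fun s => a * x s) δ' t = prediction x δ t := by
  rw [prediction, prediction, ← weight_scale ha x hδ]
  ring

end OnlineLinear

theorem theorem7 (ℓ : ℝ → ℝ → ℝ)
    (hconv : ∀ y : ℝ, ConvexOn ℝ Set.univ (ℓ y))
    (hlip : ∀ y : ℝ, LipschitzWith 1 (ℓ y)) :
    -- regret bound in dimension one: linearized regret and regret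
    (∀ (w : ℝ) (T : ℕ), 1 ≤ T → ∀ x y δ : ℕ → ℝ, x 1 ≠ 0 →
      (∀ t ∈ Finset.Icc 1 T,
        δ t ∈ OnlineLinear.subdifferential (ℓ (y t)) (OnlineLinear.prediction x δ t)) →
      ∑ t ∈ Finset.Icc 1 T, δ t * x t * (OnlineLinear.weight x δ t - w)
          ≤ OnlineLinear.regretBound x δ w T ∧
      ∑ t ∈ Finset.Icc 1 T, ℓ (y t) (OnlineLinear.prediction x δ t)
          - ∑ t ∈ Finset.Icc 1 T, ℓ (y t) (w * x t)
          ≤ OnlineLinear.regretBound x δ w T) ∧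
    -- size of the quantities `B_T` and `c_T` in the bound
    (∀ (T : ℕ), 1 ≤ T → ∀ x : ℕ → ℝ, x 1 ≠ 0 →
      OnlineLinear.ratioSum x T ≤ T ∧
      OnlineLinear.ratioConst x T ≤ 2 * (T : ℝ) ^ 5 ∧
      (4 ≤ T → OnlineLinear.ratioConst x T ≤ (T : ℝ) ^ 5)) ∧
    -- scale-invariance of the predictions in dimension one
    (∀ (x δ δ' : ℕ → ℝ) (a : ℝ) (t : ℕ), x 1 ≠ 0 → 0 < a → 1 ≤ t →
      (∀ s, 1 ≤ s → s < t → δ' s = δ s) →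
      OnlineLinear.prediction (fun s => a * x s) δ' t = OnlineLinear.prediction x δ t) ∧
    -- the coordinate-wise algorithm: linearized regret and regret
    (∀ (d : ℕ) (w : Fin d → ℝ) (T : ℕ), 1 ≤ T → ∀ (x : ℕ → Fin d → ℝ) (y δ : ℕ → ℝ),
      (∀ i, x 1 i ≠ 0) →
      (∀ t ∈ Finset.Icc 1 T,
        δ t ∈ OnlineLinear.subdifferential (ℓ (y t)) (OnlineLinear.coordPrediction x δ t)) →
      ∑ t ∈ Finset.Icc 1 T,
          δ t * ∑ i, x t i * (OnlineLinear.weight (fun s => x s i) δ t - w i)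
          ≤ ∑ i, OnlineLinear.regretBound (fun s => x s i) δ (w i) T ∧
      ∑ t ∈ Finset.Icc 1 T, ℓ (y t) (OnlineLinear.coordPrediction x δ t)
          - ∑ t ∈ Finset.Icc 1 T, ℓ (y t) (∑ i, w i * x t i)
          ≤ ∑ i, OnlineLinear.regretBound (fun s => x s i) δ (w i) T) ∧
    -- coordinate-wise scale-invariance of its predictions
    (∀ (d : ℕ) (x : ℕ → Fin d → ℝ) (δ δ' : ℕ → ℝ) (a : Fin d → ℝ) (t : ℕ),
      (∀ i, x 1 i ≠ 0) → (∀ i, 0 < a i) → 1 ≤ t →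
      (∀ s, 1 ≤ s → s < t → δ' s = δ s) →
      OnlineLinear.coordPrediction (fun s i => a i * x s i) δ' t
        = OnlineLinear.coordPrediction x δ t) := by
  refine ⟨?_, ?_, ?_, ?_, ?_⟩
  · intro w T hT x y δ hx hδ
    have hlin := OnlineLinear.linearized_regret_le hx hT
      (fun t ht => OnlineLinear.abs_le_one_of_mem_subdifferential (hlip (y t)) (hδ t ht)) w
    refine ⟨hlin, (OnlineLinear.sum_sub_sum_le_of_mem_subdifferential
      (ℓ := fun t => ℓ (y t)) (z := fun t => w * x t) hδ).trans (le_trans (le_of_eq ?_) hlin)⟩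
    refine Finset.sum_congr rfl fun t _ => ?_
    rw [OnlineLinear.prediction]
    ring
  · intro T hT x _
    exact ⟨OnlineLinear.ratioSum_le x T, OnlineLinear.ratioConst_le_two_mul_pow hT,
      OnlineLinear.ratioConst_le_pow⟩
  · intro x δ δ' a t _ ha _ hδ
    exact OnlineLinear.prediction_scale ha x hδ
  · intro d w T hT x y δ hx hδ
    -- The one-dimensional linearized bound needs only `|δ t| ≤ 1`, not a sub-gradient at the
    -- coordinate's own prediction, so it applies to each coordinate.
    have hδ1 : ∀ t ∈ Finset.Icc 1 T, |δ t| ≤ 1 := fun t ht =>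
      OnlineLinear.abs_le_one_of_mem_subdifferential (hlip (y t)) (hδ t ht)
    have hlin : ∑ t ∈ Finset.Icc 1 T,
        δ t * ∑ i, x t i * (OnlineLinear.weight (fun s => x s i) δ t - w i)
        ≤ ∑ i, OnlineLinear.regretBound (fun s => x s i) δ (w i) T := by
      simp only [Finset.mul_sum]
      rw [Finset.sum_comm]
      refine Finset.sum_le_sum fun i _ => ?_
      simp only [← mul_assoc]
      exact OnlineLinear.linearized_regret_le (x := fun s => x s i) (hx i) hT hδ1 (w i)
    refine ⟨hlin, (OnlineLinear.sum_sub_sum_le_of_mem_subdifferential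
      (ℓ := fun t => ℓ (y t)) (z := fun t => ∑ i, w i * x t i) hδ).trans
        (le_trans (le_of_eq ?_) hlin)⟩
    refine Finset.sum_congr rfl fun t _ => ?_
    rw [OnlineLinear.coordPrediction, ← Finset.sum_sub_distrib]
    congr 1
    refine Finset.sum_congr rfl fun i _ => ?_
    ring
  · intro d x δ δ' a t _ ha _ hδ
    unfold OnlineLinear.coordPrediction
    refine Finset.sum_congr rfl fun i _ => ?_
    exact OnlineLinear.prediction_scale (ha i) (fun s => x s i) hδ
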